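/- Let $p\ge 5$ be a prime number, let $\mathcal K$ be a complete non-Archimedean valued field of characteristic $p$ with absolute value $|\cdot|$, and let $\lambda\in\mathcal K$ be an element that is not a root of unity and satisfies $|1-\lambda|<1$. Let $a_1,a_2\in\mathcal K$ with $$a_1\neq 0,\qquad \left|1-\frac{a_2}{a_1^2}\right|\ge 1\qquad\text{and}\qquad \left|1-\frac{a_2}{a_1^2}\right|\neq\frac{1}{|1-\lambda|}.$$ Then the polynomial $f(z)=\lambda z+a_1z^2+a_2z^3\in\mathcal K[z]$ is non-linearizable at $z=0$; that is, there is no power series $h(z)=z\sum_{n\ge 0}b_nz^n\in\mathcal K[\![z]\!]$ with $b_0\neq 0$ which converges on some open disc of positive radius around $0$ and satisfies $h\circ f\circ h^{-1}(z)=\lambda z$, where $h^{-1}$ is the inverse of $h$ for composition. -/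

import Mathlib

/-- A formal power series over a normed field is locally analytic at `z = 0` if it converges at
every point of some open ball of positive radius centred at `0`. -/
def IsLocallyAnalytic {K : Type*} [NormedField K] (f : PowerSeries K) : Prop :=
  ∃ r : ℝ, 0 < r ∧ ∀ z : K, ‖z‖ < r → Summable (fun n : ℕ => PowerSeries.coeff n f * z ^ n)

/-- A power series `f(z) = z (lam + a₁ z + ...)` is locally linearizable at `z = 0` if there is a
locally analytic power series `h(z) = z (b₀ + b₁ z + ...)`, invertible for composition
(that is, `b₀ ≠ 0`), such that `h ∘ f ∘ h⁻¹ (z) = lam z`.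

In Mathlib, `h.subst f` is the composition `h ∘ f`, and `h.substInvOfIsUnit hb` is the
compositional inverse `h⁻¹` of `h`. -/
def IsLocallyLinearizable {K : Type*} [NormedField K] (f : PowerSeries K) : Prop :=
  ∃ (h : PowerSeries K) (hb : IsUnit (PowerSeries.coeff 1 h)),
    PowerSeries.constantCoeff h = 0 ∧ IsLocallyAnalytic h ∧
      PowerSeries.subst (h.substInvOfIsUnit hb) (PowerSeries.subst f h) =
        PowerSeries.C (PowerSeries.coeff 1 f) * PowerSeries.X

/-!
Write `f = L z (1 + ...)` with `‖L - 1‖ < 1`. In a coordinate `ψ` tangent to the identity `f` is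
`z ↦ L z (1 + r(z))`, and a linearization amounts to a solution `u`, with `u(0) = 1`, of

  `u(L z (1 + r(z))) (1 + r(z)) = u(z)`.

The small divisor `L ^ k - 1` has norm `‖L - 1‖` except in the resonant degrees, the multiples of
`p`. Removing the nonresonant part of the cocycle leaves `1 + G(z ^ p)`, where `1 + G` is a
cocycle over the map with multiplier `L ^ p` and displacement the Frobenius twist of `r`, solved
by the resonant part of `u`. This renormalization step can be iterated, and
`‖L ^ p - 1‖ = ‖L - 1‖ ^ p`.

What keeps the step under control is that in characteristic `p` a logarithmic derivative
`z a'(z) / a(z) = ∑ lₖ z ^ k` satisfies `lₚₖ = lₖ ^ p`: a nonresonant term of degree `1` or `2`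
which dominates the cocycle reappears, with its size determined, in degree `p` or `2 p`, hence in
degree `1` or `2` after renormalization. Relative to `‖L ^ p - 1‖` these terms grow at each step,
which forces the coefficients of `u` to grow faster than any geometric rate.

It remains to exhibit a dominant resonant term of degree `p` or `2 p` for
`f = (1 + ε) z + ε α z ^ 2 + ε β z ^ 3`, which up to one monomial is the Euler step of size `ε`
for the vector field `z + γ z ^ (n + 1)`, with `n = 1`, `γ = α` or `n = 2`, `γ = β`. The
coordinate `ψ = z φ` with `φ ^ n (1 - γ z ^ n) = 1` linearizes this field, so that `r` is small
and its leading part explicit. For `n = 1` it is a geometric series; for `n = 2` its odd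
coefficients are those of `(1 - β z ^ 2) ^ (1 / 2)`, given by Catalan numbers which up to degree
`p` are prime to `p`.
-/

namespace LocalLinearization

open PowerSeries

section CartierRelation

variable {K : Type*} [Field K]

/-- The logarithmic derivative `X * a' / a` of a power series `a`, taken with respect to the
Euler derivation `X * d/dX`. It is meant for `a` with nonzero constant coefficient, the other
series having inverse `0`. -/
noncomputable def eulerLogDeriv (a : K⟦X⟧) : K⟦X⟧ := X * derivative K a * a⁻¹

lemma coeff_X_mul_derivative (a : K⟦X⟧) (k : ℕ) :
    coeff k (X * derivative K a) = (k : K) * coeff k a := by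
  cases k with
  | zero => simp
  | succ n => rw [coeff_succ_X_mul, coeff_derivative]; push_cast; ring

lemma eulerLogDeriv_mul_self {a : K⟦X⟧} (ha : constantCoeff a ≠ 0) :
    eulerLogDeriv a * a = X * derivative K a := by
  rw [eulerLogDeriv, mul_assoc, PowerSeries.inv_mul_cancel a ha, mul_one]

lemma eulerLogDeriv_one : eulerLogDeriv (1 : K⟦X⟧) = 0 := by simp [eulerLogDeriv]

lemma eulerLogDeriv_mul {a b : K⟦X⟧} (ha : constantCoeff a ≠ 0) (hb : constantCoeff b ≠ 0) :
    eulerLogDeriv (a * b) = eulerLogDeriv a + eulerLogDeriv b := by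
  have ha' := PowerSeries.mul_inv_cancel a ha
  have hb' := PowerSeries.mul_inv_cancel b hb
  simp only [eulerLogDeriv, PowerSeries.mul_inv_rev, Derivation.leibniz, smul_eq_mul]
  linear_combination (X * derivative K b * b⁻¹) * ha' + (X * derivative K a * a⁻¹) * hb'

lemma X_pow_dvd_X_mul_derivative {n : ℕ} {a : K⟦X⟧} (h : X ^ n ∣ a) :
    X ^ n ∣ X * derivative K a := by
  rw [X_pow_dvd_iff] at h ⊢
  intro k hk
  rw [coeff_X_mul_derivative, h k hk, mul_zero]

lemma X_pow_dvd_eulerLogDeriv_sub {n : ℕ} {a b : K⟦X⟧} (ha : constantCoeff a ≠ 0)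
    (hb : constantCoeff b ≠ 0) (h : X ^ n ∣ a - b) :
    X ^ n ∣ eulerLogDeriv a - eulerLogDeriv b := by
  have key : eulerLogDeriv a - eulerLogDeriv b =
      (X * derivative K (a - b) - (a - b) * eulerLogDeriv b) * a⁻¹ := by
    rw [map_sub]
    linear_combination (eulerLogDeriv b - eulerLogDeriv a) * PowerSeries.mul_inv_cancel a ha +
      a⁻¹ * eulerLogDeriv_mul_self ha - a⁻¹ * eulerLogDeriv_mul_self hb
  rw [key]
  exact ((X_pow_dvd_X_mul_derivative h).sub (h.mul_right _)).mul_right _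

lemma mk_pow_mul_one_sub (c : K) : mk (c ^ ·) * (1 - C c * X) = 1 := by
  ext (_ | n)
  · simp
  · rw [mul_sub, mul_one, mul_left_comm, map_sub, coeff_C_mul, coeff_succ_mul_X]
    simp [pow_succ', coeff_one]

lemma eulerLogDeriv_one_sub (c : K) {m : ℕ} (hm : m ≠ 0) :
    eulerLogDeriv (1 - C c * X ^ m) = -(m • (expand m hm (mk (c ^ ·)) - 1)) := by
  have h0 : constantCoeff (1 - C c * X ^ m) ≠ 0 := by simp [hm]
  have hne : 1 - C c * X ^ m ≠ 0 := fun h => h0 (by simp [h])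
  have hgeom : expand m hm (mk (c ^ ·)) * (1 - C c * X ^ m) = 1 := by
    simpa [expand_C] using congrArg (expand m hm) (mk_pow_mul_one_sub c)
  refine mul_right_cancel₀ hne ?_
  rw [eulerLogDeriv_mul_self h0, nsmul_eq_mul]
  have hder : X * derivative K (1 - C c * X ^ m) = -((m : K⟦X⟧) * (C c * X ^ m)) := by
    ext k
    rw [coeff_X_mul_derivative, map_neg, ← map_natCast C, coeff_C_mul, map_sub, coeff_C_mul,
      coeff_X_pow, coeff_one]
    rcases eq_or_ne k m with rfl | hk
    · simp [hm]
    · rcases eq_or_ne k 0 with rfl | hk0 <;> simp [*]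
  linear_combination hder + (m : K⟦X⟧) * hgeom

variable {p : ℕ} [hp : Fact p.Prime] [CharP K p]

/-- The power series `l` satisfying the Cartier relation `coeff (p * n) l = coeff n l ^ p`. In
characteristic `p` logarithmic derivatives satisfy it; it is phrased with the Frobenius
endomorphism so that it visibly defines an additive subgroup. -/
def cartierFixed (K : Type*) [Field K] (p : ℕ) [Fact p.Prime] [CharP K p] :
    AddSubgroup K⟦X⟧ where
  carrier := {l | ∀ n, coeff (p * n) l = frobenius K p (coeff n l)}
  zero_mem' n := by simp
  add_mem' hl hm n := by simp only [map_add, hl n, hm n]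
  neg_mem' hl n := by simp only [map_neg, hl n]

lemma mem_cartierFixed {l : K⟦X⟧} :
    l ∈ cartierFixed K p ↔ ∀ n, coeff (p * n) l = coeff n l ^ p := Iff.rfl

lemma one_mem_cartierFixed : (1 : K⟦X⟧) ∈ cartierFixed K p := by
  intro n
  rcases eq_or_ne n 0 with rfl | hn
  · simp
  · simp [coeff_one, hn, hp.out.ne_zero]

lemma expand_mem_cartierFixed {l : K⟦X⟧} (hl : l ∈ cartierFixed K p) {m : ℕ} (hm : m ≠ 0)
    (hpm : ¬ p ∣ m) : expand m hm l ∈ cartierFixed K p := by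
  intro n
  have hco : m.Coprime p := ((hp.out.coprime_iff_not_dvd).2 hpm).symm
  by_cases hmn : m ∣ n
  · obtain ⟨j, rfl⟩ := hmn
    rw [mul_left_comm, coeff_expand_mul, coeff_expand_mul, hl j]
  · rw [coeff_expand_of_not_dvd m hm l hmn,
      coeff_expand_of_not_dvd m hm l (by rwa [hco.dvd_mul_left]), map_zero]

lemma eulerLogDeriv_one_sub_mem_cartierFixed (c : K) {m : ℕ} (hm : m ≠ 0) :
    eulerLogDeriv (1 - C c * X ^ m) ∈ cartierFixed K p := by
  rw [eulerLogDeriv_one_sub c hm]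
  by_cases hpm : p ∣ m
  · have : (m : K⟦X⟧) = 0 := by
      rw [← map_natCast C, (CharP.cast_eq_zero_iff K p m).2 hpm, map_zero]
    simp [nsmul_eq_mul, this]
  · have hgeom : mk (c ^ ·) ∈ cartierFixed K p := fun n => by
      simp [mul_comm p n, pow_mul, frobenius_def]
    exact neg_mem (nsmul_mem (sub_mem (expand_mem_cartierFixed hgeom hm hpm)
      one_mem_cartierFixed) m)

lemma exists_eulerLogDeriv_mem_cartierFixed_approx {a : K⟦X⟧} (ha : constantCoeff a = 1) (N : ℕ) :
    ∃ b : K⟦X⟧, constantCoeff b = 1 ∧ eulerLogDeriv b ∈ cartierFixed K p ∧ X ^ (N + 1) ∣ a - b := by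
  induction N with
  | zero =>
    refine ⟨1, map_one _, by simp [eulerLogDeriv_one], ?_⟩
    simp [X_dvd_iff, ha]
  | succ N ih =>
    obtain ⟨b, hb, hmem, d, hd⟩ := ih
    have hfac : constantCoeff (1 - C (-constantCoeff d) * X ^ (N + 1)) = 1 := by simp
    refine ⟨b * (1 - C (-constantCoeff d) * X ^ (N + 1)), ?_, ?_, ?_⟩
    · rw [map_mul, hb, hfac, one_mul]
    · rw [eulerLogDeriv_mul (by simp [hb]) (by simp)]
      exact add_mem hmem (eulerLogDeriv_one_sub_mem_cartierFixed _ N.succ_ne_zero)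
    · have hX : X ∣ d - b * C (constantCoeff d) := by simp [X_dvd_iff, hb]
      have hsplit : a - b * (1 - C (-constantCoeff d) * X ^ (N + 1)) =
          X ^ (N + 1) * (d - b * C (constantCoeff d)) := by
        rw [map_neg]
        linear_combination hd
      rw [hsplit, pow_succ]
      exact mul_dvd_mul_left _ hX

theorem eulerLogDeriv_mem_cartierFixed {a : K⟦X⟧} (ha : constantCoeff a = 1) :
    eulerLogDeriv a ∈ cartierFixed K p := by
  intro n
  obtain ⟨b, hb, hmem, hdvd⟩ :=
    exists_eulerLogDeriv_mem_cartierFixed_approx (p := p) ha (p * n + n)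
  have hcoeff : ∀ k < p * n + n + 1, coeff k (eulerLogDeriv a) = coeff k (eulerLogDeriv b) := by
    have h := X_pow_dvd_eulerLogDeriv_sub (by simp [ha]) (by simp [hb]) hdvd
    simpa only [X_pow_dvd_iff, map_sub, sub_eq_zero] using h
  rw [hcoeff _ (by omega), hcoeff _ (by omega), hmem n]

end CartierRelation

section UltrametricNorm

variable {K : Type*} [NormedField K] {p : ℕ} [hp : Fact p.Prime] [CharP K p]

lemma norm_natCast_eq_one_of_not_dvd {k : ℕ} (h : ¬ p ∣ k) : ‖(k : K)‖ = 1 := by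
  have hk : (k : ZMod p) ≠ 0 := by rwa [Ne, ZMod.natCast_eq_zero_iff]
  have hpow : (k : K) ^ (p - 1) = 1 := by
    simpa using congrArg (ZMod.castHom dvd_rfl K) (ZMod.pow_card_sub_one_eq_one hk)
  refine (pow_eq_one_iff_of_nonneg (norm_nonneg _) (Nat.sub_ne_zero_of_lt hp.out.one_lt)).1 ?_
  rw [← norm_pow, hpow, norm_one]

lemma norm_pow_char_sub_one (x : K) : ‖x ^ p - 1‖ = ‖x - 1‖ ^ p := by
  rw [← norm_pow, sub_pow_char, one_pow]

variable [IsUltrametricDist K] {x y : K} {B : ℝ}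

lemma norm_add_le_of_norm_le (hx : ‖x‖ ≤ B) (hy : ‖y‖ ≤ B) : ‖x + y‖ ≤ B :=
  (IsUltrametricDist.norm_add_le_max x y).trans (max_le hx hy)

lemma norm_sub_le_of_norm_le (hx : ‖x‖ ≤ B) (hy : ‖y‖ ≤ B) : ‖x - y‖ ≤ B := by
  rw [sub_eq_add_neg]
  exact norm_add_le_of_norm_le hx (by rwa [norm_neg])

lemma norm_eq_of_norm_sub_lt (h : ‖x - y‖ < ‖y‖) : ‖x‖ = ‖y‖ := by
  simpa [h.le] using IsUltrametricDist.norm_add_eq_max_of_norm_ne_norm h.ne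

lemma norm_eq_one_of_norm_sub_one_lt (h : ‖x - 1‖ < 1) : ‖x‖ = 1 := by
  rw [norm_eq_of_norm_sub_lt (y := (1 : K)) (by rwa [norm_one]), norm_one]

lemma norm_pow_sub_one_le (h : ‖x - 1‖ < 1) (k : ℕ) : ‖x ^ k - 1‖ ≤ ‖x - 1‖ := by
  induction k with
  | zero => simp
  | succ k ih =>
    rw [show x ^ (k + 1) - 1 = (x ^ k - 1) * x + (x - 1) by ring]
    refine norm_add_le_of_norm_le ?_ le_rfl
    rwa [norm_mul, norm_eq_one_of_norm_sub_one_lt h, mul_one]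

lemma norm_pow_sub_one_sub_le (h : ‖x - 1‖ < 1) (k : ℕ) :
    ‖x ^ k - 1 - k * (x - 1)‖ ≤ ‖x - 1‖ ^ 2 := by
  induction k with
  | zero => simp
  | succ k ih =>
    rw [show x ^ (k + 1) - 1 - (k + 1 : ℕ) * (x - 1) =
      (x ^ k - 1 - k * (x - 1)) + (x ^ k - 1) * (x - 1) by push_cast; ring]
    refine norm_add_le_of_norm_le ih ?_
    rw [norm_mul, pow_two]
    gcongr
    exact norm_pow_sub_one_le h k

lemma norm_pow_sub_one_of_not_dvd (h : ‖x - 1‖ < 1) {k : ℕ} (hk : ¬ p ∣ k) :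
    ‖x ^ k - 1‖ = ‖x - 1‖ := by
  rcases eq_or_ne x 1 with rfl | hx
  · simp
  have hmul : ‖(k : K) * (x - 1)‖ = ‖x - 1‖ := by
    rw [norm_mul, norm_natCast_eq_one_of_not_dvd hk, one_mul]
  rw [← hmul]
  refine norm_eq_of_norm_sub_lt ((norm_pow_sub_one_sub_le h k).trans_lt ?_)
  rw [hmul]
  exact pow_lt_self_of_lt_one₀ (norm_pos_iff.2 (sub_ne_zero.2 hx)) h one_lt_two

end UltrametricNorm

section CoeffBound

variable {K : Type*} [NormedField K]

/-- The coefficients of `a` satisfy `‖aₖ‖ ≤ c * V ^ k`. For `0 < V` this says that `a` is bounded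
by `c` on the open disc of radius `1 / V`. -/
structure CoeffBound (c V : ℝ) (a : K⟦X⟧) : Prop where
  rate_nonneg : 0 ≤ V
  norm_coeff_le : ∀ k, ‖coeff k a‖ ≤ c * V ^ k

variable {c d V W : ℝ} {a b : K⟦X⟧}

namespace CoeffBound

lemma nonneg (h : CoeffBound c V a) : 0 ≤ c := by
  simpa using (norm_nonneg _).trans (h.norm_coeff_le 0)

lemma mono (h : CoeffBound c V a) (hcd : c ≤ d) : CoeffBound d V a where
  rate_nonneg := h.rate_nonneg
  norm_coeff_le k :=
    (h.norm_coeff_le k).trans (mul_le_mul_of_nonneg_right hcd (pow_nonneg h.rate_nonneg k))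

lemma mono_rate (h : CoeffBound c V a) (hVW : V ≤ W) : CoeffBound c W a where
  rate_nonneg := h.rate_nonneg.trans hVW
  norm_coeff_le k := (h.norm_coeff_le k).trans
    (mul_le_mul_of_nonneg_left (pow_le_pow_left₀ h.rate_nonneg hVW k) h.nonneg)

lemma neg (h : CoeffBound c V a) : CoeffBound c V (-a) where
  rate_nonneg := h.rate_nonneg
  norm_coeff_le k := by simpa using h.norm_coeff_le k

lemma C_mul (h : CoeffBound c V a) (x : K) : CoeffBound (‖x‖ * c) V (C x * a) where
  rate_nonneg := h.rate_nonneg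
  norm_coeff_le k := by
    rw [coeff_C_mul, norm_mul, mul_assoc]
    exact mul_le_mul_of_nonneg_left (h.norm_coeff_le k) (norm_nonneg x)

lemma C_mul_X_pow {x : K} {m : ℕ} (hc : 0 ≤ c) (hV : 0 ≤ V) (hx : ‖x‖ ≤ c * V ^ m) :
    CoeffBound c V (C x * X ^ m) where
  rate_nonneg := hV
  norm_coeff_le k := by
    rw [coeff_C_mul, coeff_X_pow]
    split_ifs with h
    · simpa [h] using hx
    · simp only [mul_zero, norm_zero]; positivity

lemma of_C (hV : 0 ≤ V) (x : K) : CoeffBound ‖x‖ V (C x) := by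
  simpa using C_mul_X_pow (m := 0) (norm_nonneg x) hV (by simp)

lemma one (hV : 0 ≤ V) : CoeffBound 1 V (1 : K⟦X⟧) := by simpa using of_C hV (1 : K)

end CoeffBound

lemma mul_le_mul_mul_pow {x y : ℝ} {i j : ℕ} (hV : 0 ≤ V) (hc : 0 ≤ c) (hy : 0 ≤ y)
    (hx : x ≤ c * V ^ i) (hyd : y ≤ d * V ^ j) : x * y ≤ c * d * V ^ (i + j) := by
  rw [pow_add, mul_mul_mul_comm]
  exact mul_le_mul hx hyd hy (by positivity)

variable [IsUltrametricDist K]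

lemma norm_coeff_mul_le {B : ℝ} {k : ℕ} (hB : 0 ≤ B)
    (h : ∀ i j, i + j = k → ‖coeff i a‖ * ‖coeff j b‖ ≤ B) : ‖coeff k (a * b)‖ ≤ B := by
  rw [coeff_mul]
  refine IsUltrametricDist.norm_sum_le_of_forall_le_of_nonneg hB fun x hx => ?_
  rw [norm_mul]
  exact h _ _ (Finset.HasAntidiagonal.mem_antidiagonal.1 hx)

namespace CoeffBound

lemma add (ha : CoeffBound c V a) (hb : CoeffBound c V b) : CoeffBound c V (a + b) where
  rate_nonneg := ha.rate_nonneg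
  norm_coeff_le k := by
    rw [map_add]
    exact norm_add_le_of_norm_le (ha.norm_coeff_le k) (hb.norm_coeff_le k)

lemma sub (ha : CoeffBound c V a) (hb : CoeffBound c V b) : CoeffBound c V (a - b) := by
  rw [sub_eq_add_neg]
  exact ha.add hb.neg

lemma mul (ha : CoeffBound c V a) (hb : CoeffBound d V b) : CoeffBound (c * d) V (a * b) where
  rate_nonneg := ha.rate_nonneg
  norm_coeff_le k := by
    have hV := ha.rate_nonneg
    have hc := ha.nonneg
    have hd := hb.nonneg
    refine norm_coeff_mul_le (by positivity) fun i j hij => ?_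
    rw [← hij]
    exact mul_le_mul_mul_pow hV hc (norm_nonneg _) (ha.norm_coeff_le i) (hb.norm_coeff_le j)

lemma sq (ha : CoeffBound 1 V a) : CoeffBound 1 V (a ^ 2) := by
  simpa [pow_two] using ha.mul ha

lemma natCast_mul (h : CoeffBound c V a) (n : ℕ) : CoeffBound c V ((n : K⟦X⟧) * a) := by
  rw [← map_natCast C]
  exact (h.C_mul (n : K)).mono
    (mul_le_of_le_one_left h.nonneg (IsUltrametricDist.norm_natCast_le_one K n))

lemma of_sub_one (h : CoeffBound c V (a - 1)) (hc : c ≤ 1) : CoeffBound 1 V a := by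
  simpa using (h.mono hc).add (one h.rate_nonneg)

lemma one_add_pow_sub_one (h : CoeffBound c V a) (hc : c ≤ 1) (j : ℕ) :
    CoeffBound c V ((1 + a) ^ j - 1) := by
  induction j with
  | zero => simpa using h.natCast_mul 0
  | succ j ih =>
    have h1 : CoeffBound 1 V (1 + a) := of_sub_one (by simpa using h) hc
    rw [show (1 + a) ^ (j + 1) - 1 = ((1 + a) ^ j - 1) * (1 + a) + a by ring]
    exact add (by simpa using ih.mul h1) h

lemma of_mul (ha : CoeffBound 1 V a) (ha0 : ‖constantCoeff a‖ = 1) (h : CoeffBound c V (a * b)) :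
    CoeffBound c V b where
  rate_nonneg := h.rate_nonneg
  norm_coeff_le k := by
    have hV := h.rate_nonneg
    have hc := h.nonneg
    induction k using Nat.strong_induction_on with
    | _ k ih =>
      have hsplit : constantCoeff a * coeff k b =
          coeff k (a * b) - coeff k ((a - C (constantCoeff a)) * b) := by
        rw [sub_mul, map_sub, coeff_C_mul, sub_sub_cancel]
      rw [← one_mul ‖coeff k b‖, ← ha0, ← norm_mul, hsplit]
      refine norm_sub_le_of_norm_le (h.norm_coeff_le k)
        (norm_coeff_mul_le (by positivity) fun i j hij => ?_)
      rcases i.eq_zero_or_pos with rfl | hi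
      · simp only [map_sub, coeff_zero_eq_constantCoeff, constantCoeff_C, sub_self, norm_zero,
          zero_mul]
        positivity
      · rw [map_sub, coeff_C, if_neg hi.ne', sub_zero, ← hij, ← one_mul c]
        exact mul_le_mul_mul_pow hV zero_le_one (norm_nonneg _) (ha.norm_coeff_le i)
          (ih j (by omega))

lemma of_two_mul_add_sq (ha0 : constantCoeff a = 0) (h2 : ‖(2 : K)‖ = 1) (hc1 : c ≤ 1)
    (h : CoeffBound c V (2 * a + a ^ 2)) : CoeffBound c V a where
  rate_nonneg := h.rate_nonneg
  norm_coeff_le k := by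
    have hV := h.rate_nonneg
    have hc := h.nonneg
    induction k using Nat.strong_induction_on with
    | _ k ih =>
      have hsplit : 2 * coeff k a = coeff k (2 * a + a ^ 2) - coeff k (a * a) := by
        rw [← pow_two, map_add, add_sub_cancel_right, ← map_ofNat C, coeff_C_mul]
      rw [← one_mul ‖coeff k a‖, ← h2, ← norm_mul, hsplit]
      refine norm_sub_le_of_norm_le (h.norm_coeff_le k)
        (norm_coeff_mul_le (by positivity) fun i j hij => ?_)
      rcases i.eq_zero_or_pos with rfl | hi
      · simp only [coeff_zero_eq_constantCoeff, ha0, norm_zero, zero_mul]; positivity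
      rcases j.eq_zero_or_pos with rfl | hj
      · simp only [coeff_zero_eq_constantCoeff, ha0, norm_zero, mul_zero]; positivity
      rw [← hij]
      refine (mul_le_mul_mul_pow hV hc (norm_nonneg _) (ih i (by omega))
        (ih j (by omega))).trans ?_
      gcongr
      exact mul_le_of_le_one_left hc hc1

end CoeffBound

end CoeffBound

section NearLinear

variable {K : Type*} [Field K]

/-- The power series `L * X * (1 + r)`. If `r` has constant coefficient `0` this is a map with
multiplier `L` at the fixed point `0`, and `r` measures its relative distance to the rotation
`L * X`. -/
noncomputable def nearLinear (L : K) (r : K⟦X⟧) : K⟦X⟧ := C L * X * (1 + r)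

lemma hasSubst_nearLinear (L : K) (r : K⟦X⟧) : HasSubst (nearLinear L r) :=
  HasSubst.of_constantCoeff_zero' (by simp [nearLinear])

lemma coeff_subst_nearLinear (L : K) (r a : K⟦X⟧) (k : ℕ) :
    coeff k (a.subst (nearLinear L r)) =
      ∑ j ∈ Finset.range (k + 1), coeff j a * L ^ j * coeff (k - j) ((1 + r) ^ j) := by
  have hpow (j : ℕ) : coeff k (nearLinear L r ^ j) =
      if j ≤ k then L ^ j * coeff (k - j) ((1 + r) ^ j) else 0 := by
    rw [nearLinear, mul_pow, mul_pow, ← map_pow, mul_assoc, coeff_C_mul, coeff_X_pow_mul', mul_ite,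
      mul_zero]
  rw [coeff_subst' (hasSubst_nearLinear L r),
    finsum_eq_sum_of_support_subset (s := Finset.range (k + 1))]
  · refine Finset.sum_congr rfl fun j hj => ?_
    rw [hpow, if_pos (Finset.mem_range_succ_iff.1 hj), smul_eq_mul, mul_assoc]
  · refine Function.support_subset_iff'.2 fun j hj => ?_
    rw [hpow, if_neg (by simpa using hj), smul_zero]

lemma constantCoeff_subst_nearLinear (L : K) (r a : K⟦X⟧) :
    constantCoeff (a.subst (nearLinear L r)) = constantCoeff a := by
  rw [← coeff_zero_eq_constantCoeff_apply, coeff_subst_nearLinear]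
  simp

lemma subst_nearLinear_sub_one (L : K) (r a : K⟦X⟧) :
    (a - 1).subst (nearLinear L r) = a.subst (nearLinear L r) - 1 := by
  rw [← coe_substAlgHom (hasSubst_nearLinear L r), map_sub, map_one]

lemma coeff_subst_nearLinear_sub {L : K} {r : K⟦X⟧} (hr0 : constantCoeff r = 0) (a : K⟦X⟧)
    (k : ℕ) :
    coeff k (a.subst (nearLinear L r)) - L ^ k * coeff k a =
      ∑ j ∈ Finset.range k, coeff j a * L ^ j * coeff (k - j) ((1 + r) ^ j - 1) := by
  have hdiag : coeff (k - k) ((1 + r) ^ k) = 1 := by simp [hr0]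
  rw [coeff_subst_nearLinear, Finset.sum_range_succ, hdiag, mul_one, mul_comm (coeff k a),
    add_sub_cancel_right]
  refine Finset.sum_congr rfl fun j hj => ?_
  rw [map_sub, coeff_one, if_neg (Nat.sub_ne_zero_of_lt (Finset.mem_range.1 hj)), sub_zero]

variable {p : ℕ} [hp : Fact p.Prime] [CharP K p]

lemma expand_map_frobenius (a : K⟦X⟧) :
    expand p hp.out.ne_zero (map (frobenius K p) a) = a ^ p := by
  rw [← map_expand]
  exact MvPowerSeries.map_frobenius_expand p hp.out.ne_zero

lemma expand_nearLinear (L : K) (r : K⟦X⟧) :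
    expand p hp.out.ne_zero (nearLinear (L ^ p) (map (frobenius K p) r)) = nearLinear L r ^ p := by
  have : CharP K⟦X⟧ p := charP_of_injective_ringHom (f := C) C_injective p
  simp only [nearLinear, map_mul, map_add, map_one, expand_C, expand_X, expand_map_frobenius,
    mul_pow, add_pow_char, one_pow, map_pow]

lemma expand_subst_nearLinear (L : K) (r a : K⟦X⟧) :
    (expand p hp.out.ne_zero a).subst (nearLinear L r) =
      expand p hp.out.ne_zero (a.subst (nearLinear (L ^ p) (map (frobenius K p) r))) := by
  have hX : HasSubst (X ^ p : K⟦X⟧) := HasSubst.X_pow hp.out.ne_zero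
  rw [expand_apply, expand_apply, subst_comp_subst_apply hX (hasSubst_nearLinear L r),
    subst_comp_subst_apply (hasSubst_nearLinear _ _) hX, subst_pow (hasSubst_nearLinear L r),
    subst_X (hasSubst_nearLinear L r), ← expand_apply _ hp.out.ne_zero, expand_nearLinear]

end NearLinear

section NearLinearBound

variable {K : Type*} [NormedField K] [IsUltrametricDist K] {L : K} {r a : K⟦X⟧} {c d V : ℝ}

lemma norm_coeff_subst_nearLinear_sub_le (hL : ‖L‖ = 1) (hr0 : constantCoeff r = 0)
    (hr : CoeffBound d V r) (hd : d ≤ 1) (hc : 0 ≤ c) {k : ℕ}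
    (ha : ∀ j, 0 < j → j < k → ‖coeff j a‖ ≤ c * V ^ j) :
    ‖coeff k (a.subst (nearLinear L r)) - L ^ k * coeff k a‖ ≤ c * d * V ^ k := by
  have hV := hr.rate_nonneg
  have hd0 := hr.nonneg
  rw [coeff_subst_nearLinear_sub hr0]
  refine IsUltrametricDist.norm_sum_le_of_forall_le_of_nonneg (by positivity) fun j hj => ?_
  have hjk := Finset.mem_range.1 hj
  rcases j.eq_zero_or_pos with rfl | hj0
  · simp only [pow_zero, sub_self, map_zero, mul_zero, norm_zero]
    positivity
  rw [norm_mul, norm_mul, norm_pow, hL, one_pow, mul_one]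
  simpa only [Nat.add_sub_cancel' hjk.le] using mul_le_mul_mul_pow hV hc (norm_nonneg _)
    (ha j hj0 hjk) ((hr.one_add_pow_sub_one hd j).norm_coeff_le (k - j))

lemma CoeffBound.subst_nearLinear (ha : CoeffBound c V a) (hL : ‖L‖ = 1)
    (hr0 : constantCoeff r = 0) (hr : CoeffBound d V r) (hd : d ≤ 1) :
    CoeffBound c V (a.subst (nearLinear L r)) where
  rate_nonneg := ha.rate_nonneg
  norm_coeff_le k := by
    have hV := ha.rate_nonneg
    have hc := ha.nonneg
    rw [← sub_add_cancel (coeff k _) (L ^ k * coeff k a)]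
    refine norm_add_le_of_norm_le ((norm_coeff_subst_nearLinear_sub_le hL hr0 hr hd hc
      fun j _ _ => ha.norm_coeff_le j).trans ?_) ?_
    · gcongr
      exact mul_le_of_le_one_right hc hd
    · rw [norm_mul, norm_pow, hL, one_pow, one_mul]
      exact ha.norm_coeff_le k

lemma CoeffBound.X_mul_derivative (ha : CoeffBound c V a) :
    CoeffBound c V (X * derivative K a) where
  rate_nonneg := ha.rate_nonneg
  norm_coeff_le k := by
    rw [coeff_X_mul_derivative, norm_mul]
    exact (mul_le_of_le_one_left (norm_nonneg _)
      (IsUltrametricDist.norm_natCast_le_one K k)).trans (ha.norm_coeff_le k)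

lemma CoeffBound.subst_nearLinear_sub_sub (ha : CoeffBound c V a) (hL : ‖L - 1‖ ≤ d) (hd : d < 1)
    (hr0 : constantCoeff r = 0) (hr : CoeffBound (‖L - 1‖ * d) V r) :
    CoeffBound (c * (‖L - 1‖ * d)) V
      (a.subst (nearLinear L r) - a - C (L - 1) * (X * derivative K a)) where
  rate_nonneg := ha.rate_nonneg
  norm_coeff_le k := by
    have hL1 := hL.trans_lt hd
    have hV := ha.rate_nonneg
    have hd1 : ‖L - 1‖ * d ≤ 1 := (mul_le_of_le_one_right (norm_nonneg _) hd.le).trans hL1.le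
    rw [map_sub, map_sub, coeff_C_mul, coeff_X_mul_derivative,
      show coeff k (a.subst (nearLinear L r)) - coeff k a - (L - 1) * (k * coeff k a) =
        (coeff k (a.subst (nearLinear L r)) - L ^ k * coeff k a) +
          (L ^ k - 1 - k * (L - 1)) * coeff k a by ring]
    refine norm_add_le_of_norm_le (norm_coeff_subst_nearLinear_sub_le
      (norm_eq_one_of_norm_sub_one_lt hL1) hr0 hr hd1 ha.nonneg fun j _ _ => ha.norm_coeff_le j) ?_
    calc ‖(L ^ k - 1 - k * (L - 1)) * coeff k a‖
        ≤ ‖L - 1‖ ^ 2 * (c * V ^ k) := by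
          rw [norm_mul]
          exact mul_le_mul (norm_pow_sub_one_sub_le hL1 k) (ha.norm_coeff_le k) (norm_nonneg _)
            (by positivity)
      _ = c * (‖L - 1‖ * ‖L - 1‖) * V ^ k := by ring
      _ ≤ c * (‖L - 1‖ * d) * V ^ k := by have := ha.nonneg; gcongr

end NearLinearBound

section Renormalization

variable {K : Type*} [Field K]

/-- The series `∑ aₚₖ Xᵏ` collecting the coefficients of `a` at the multiples of `p`. -/
noncomputable def decimate (p : ℕ) (a : K⟦X⟧) : K⟦X⟧ := mk fun k => coeff (p * k) a

lemma coeff_decimate (p : ℕ) (a : K⟦X⟧) (k : ℕ) : coeff k (decimate p a) = coeff (p * k) a :=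
  coeff_mk _ _

lemma constantCoeff_decimate (p : ℕ) (a : K⟦X⟧) :
    constantCoeff (decimate p a) = constantCoeff a := by
  simpa using coeff_decimate p a 0

lemma decimate_mul_expand {p : ℕ} (hp : p ≠ 0) (a b : K⟦X⟧) :
    decimate p (a * expand p hp b) = decimate p a * b := by
  ext k
  rw [coeff_decimate, coeff_mul, coeff_mul]
  symm
  refine Finset.sum_of_injOn (fun x => (p * x.1, p * x.2)) ?_ ?_ ?_ ?_
  · rintro ⟨i, j⟩ - ⟨i', j'⟩ - h
    simpa [hp] using h
  · rintro ⟨i, j⟩ hij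
    simp only [Finset.mem_coe, Finset.HasAntidiagonal.mem_antidiagonal] at hij ⊢
    rw [← mul_add, hij]
  · rintro ⟨i, j⟩ hij hnot
    rw [Finset.HasAntidiagonal.mem_antidiagonal] at hij
    rw [coeff_expand_of_not_dvd p hp b, mul_zero]
    rintro ⟨j', rfl⟩
    obtain ⟨i', rfl⟩ : p ∣ i := (Nat.dvd_add_left ⟨j', rfl⟩).1 ⟨k, hij⟩
    refine hnot ⟨(i', j'), ?_, rfl⟩
    simpa [← mul_add, hp] using hij
  · rintro ⟨i, j⟩ -
    rw [coeff_decimate, coeff_expand_mul]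

/-- A normalized solution `u` of the multiplicative cohomological equation
`u(L z (1 + r(z))) * (1 + g(z)) = u(z)` over the map `nearLinear L r`. -/
structure IsCohomologicalSolution (L : K) (r g u : K⟦X⟧) : Prop where
  constantCoeff_map : constantCoeff r = 0
  constantCoeff_sol : constantCoeff u = 1
  eqn : u.subst (nearLinear L r) * (1 + g) = u

/-- Multiplication by the coboundary of `v` turns the cocycle `1 + g` over `nearLinear L r` into a
cocycle `1 + H` all of whose monomials are `p`-th powers, where `v` itself has no such monomials
apart from its constant coefficient `1`. These are the resonant monomials: the small divisor
`L ^ k - 1` has norm `‖L - 1‖` unless `p` divides `k`. -/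
structure IsResonantNormalization (p : ℕ) (L : K) (r g v H : K⟦X⟧) : Prop where
  constantCoeff_map : constantCoeff r = 0
  constantCoeff_cocycle : constantCoeff g = 0
  decimate_eq_one : decimate p v = 1
  coeff_eq_zero : ∀ k, ¬ p ∣ k → coeff k H = 0
  eqn : v.subst (nearLinear L r) * (1 + g) = v * (1 + H)

namespace IsCohomologicalSolution

variable {L : K} {r g u : K⟦X⟧}

lemma constantCoeff_cocycle (h : IsCohomologicalSolution L r g u) : constantCoeff g = 0 := by
  simpa [constantCoeff_subst_nearLinear, h.constantCoeff_sol] using congrArg constantCoeff h.eqn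

theorem exists_renormalization {p : ℕ} [hp : Fact p.Prime] [CharP K p]
    (h : IsCohomologicalSolution L r g u) :
    ∃ v G : K⟦X⟧, IsResonantNormalization p L r g v (expand p hp.out.ne_zero G) ∧
      IsCohomologicalSolution (L ^ p) (map (frobenius K p) r) G (decimate p u) := by
  have hp0 := hp.out.ne_zero
  set U := decimate p u
  set S := U.subst (nearLinear (L ^ p) (map (frobenius K p) r)) with hSdef
  have hU : constantCoeff U = 1 := by rw [constantCoeff_decimate, h.constantCoeff_sol]
  have hS : constantCoeff S = 1 := by rw [hSdef, constantCoeff_subst_nearLinear, hU]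
  have hUinv : U⁻¹ * U = 1 := PowerSeries.inv_mul_cancel U (by simp [hU])
  have hSinv : S * S⁻¹ = 1 := PowerSeries.mul_inv_cancel S (by simp [hS])
  have hfactor : u = u * expand p hp0 U⁻¹ * expand p hp0 U := by
    rw [mul_assoc, ← map_mul, hUinv, map_one, mul_one]
  have heqn : S * (1 + (S⁻¹ * U - 1)) = U := by linear_combination U * hSinv
  refine ⟨u * expand p hp0 U⁻¹, S⁻¹ * U - 1,
    ⟨h.constantCoeff_map, h.constantCoeff_cocycle, ?_,
      fun _ => coeff_expand_of_not_dvd p hp0 _, ?_⟩, ⟨?_, hU, heqn⟩⟩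
  · rw [decimate_mul_expand, mul_comm, hUinv]
  · have hne : expand p hp0 S ≠ 0 := fun h0 => by
      simpa [hS] using congrArg constantCoeff h0
    have hsub :
        (u * expand p hp0 U⁻¹).subst (nearLinear L r) * expand p hp0 S * (1 + g) = u := by
      rw [hSdef, ← expand_subst_nearLinear, ← subst_mul (hasSubst_nearLinear L r), ← hfactor,
        h.eqn]
    have hexp := congrArg (expand p hp0) heqn
    rw [map_mul, map_add, map_one] at hexp
    refine mul_left_cancel₀ hne ?_
    linear_combination hsub + hfactor - u * expand p hp0 U⁻¹ * hexp
  · rw [← coeff_zero_eq_constantCoeff_apply, coeff_map, coeff_zero_eq_constantCoeff_apply,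
      h.constantCoeff_map, map_zero]

end IsCohomologicalSolution

end Renormalization

namespace IsResonantNormalization

section Field

variable {K : Type*} [Field K] {p : ℕ} {L : K} {r g v H : K⟦X⟧}

lemma constantCoeff_factor (h : IsResonantNormalization p L r g v H) : constantCoeff v = 1 := by
  rw [← constantCoeff_decimate p, h.decimate_eq_one, map_one]

lemma coeff_factor_eq_zero (h : IsResonantNormalization p L r g v H) {k : ℕ} (hk : 0 < k)
    (hpk : p ∣ k) : coeff k v = 0 := by
  obtain ⟨m, rfl⟩ := hpk
  rw [← coeff_decimate, h.decimate_eq_one, coeff_one, if_neg (Nat.pos_of_mul_pos_left hk).ne']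

lemma constantCoeff_residue (h : IsResonantNormalization p L r g v H) : constantCoeff H = 0 := by
  simpa [constantCoeff_subst_nearLinear, h.constantCoeff_factor, h.constantCoeff_cocycle] using
    (congrArg constantCoeff h.eqn).symm

lemma small_divisor_eqn (h : IsResonantNormalization p L r g v H) (k : ℕ) :
    (L ^ k - 1) * coeff k v - coeff k H = coeff k ((v - 1) * H) -
      coeff k (g * v.subst (nearLinear L r)) -
      (coeff k (v.subst (nearLinear L r)) - L ^ k * coeff k v) := by
  have heqn := congrArg (coeff k) (show v + H + (v - 1) * H = v.subst (nearLinear L r) +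
    g * v.subst (nearLinear L r) by linear_combination -h.eqn)
  simp only [map_add] at heqn
  linear_combination -heqn

end Field

variable {K : Type*} [NormedField K] [IsUltrametricDist K] {p : ℕ} {L : K} {r g v H : K⟦X⟧}
  {V mu th : ℝ}

lemma norm_small_divisor_le (h : IsResonantNormalization p L r g v H) (hL : ‖L - 1‖ < 1)
    (hmu : mu ≤ 1) (hr : CoeffBound (‖L - 1‖ * mu) V r) (hg : CoeffBound (‖L - 1‖ * mu) V g)
    {k : ℕ} (ih : ∀ j, 0 < j → j < k →
      ‖coeff j v‖ ≤ mu * V ^ j ∧ ‖coeff j H‖ ≤ ‖L - 1‖ * mu * V ^ j) :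
    ‖(L ^ k - 1) * coeff k v - coeff k H‖ ≤ ‖L - 1‖ * mu * V ^ k := by
  set e := ‖L - 1‖
  have hV := hr.rate_nonneg
  have hemu0 := hr.nonneg
  have hemu : e * mu ≤ 1 := (mul_le_of_le_one_right (norm_nonneg _) hmu).trans hL.le
  have hLn := norm_eq_one_of_norm_sub_one_lt hL
  have hv (j : ℕ) (hj : j < k) : ‖coeff j v‖ ≤ 1 * V ^ j := by
    rcases j.eq_zero_or_pos with rfl | hj0
    · simp [h.constantCoeff_factor]
    · exact (ih j hj0 hj).1.trans (by gcongr)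
  have hdiff (j : ℕ) (hj : j ≤ k) :
      ‖coeff j (v.subst (nearLinear L r)) - L ^ j * coeff j v‖ ≤ e * mu * V ^ j := by
    simpa using norm_coeff_subst_nearLinear_sub_le hLn h.constantCoeff_map hr hemu zero_le_one
      fun i _ hi => hv i (hi.trans_le hj)
  have hS (j : ℕ) (hj : j < k) : ‖coeff j (v.subst (nearLinear L r))‖ ≤ 1 * V ^ j := by
    rw [← sub_add_cancel (coeff j _) (L ^ j * coeff j v)]
    refine norm_add_le_of_norm_le ((hdiff j hj.le).trans (by gcongr)) ?_
    rw [norm_mul, norm_pow, hLn, one_pow, one_mul]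
    exact hv j hj
  rw [h.small_divisor_eqn]
  refine norm_sub_le_of_norm_le (norm_sub_le_of_norm_le ?_ ?_) (hdiff k le_rfl)
  · rw [mul_comm]
    refine norm_coeff_mul_le (by positivity) fun i j hij => ?_
    rcases i.eq_zero_or_pos with rfl | hi
    · simp only [coeff_zero_eq_constantCoeff, h.constantCoeff_residue, norm_zero, zero_mul]
      positivity
    rcases j.eq_zero_or_pos with rfl | hj
    · simp only [coeff_zero_eq_constantCoeff, map_sub, h.constantCoeff_factor, map_one, sub_self,
        norm_zero, mul_zero]
      positivity
    rw [map_sub, coeff_one, if_neg hj.ne', sub_zero, ← hij, ← mul_one (e * mu)]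
    exact mul_le_mul_mul_pow hV hemu0 (norm_nonneg _) (ih i hi (by omega)).2 (hv j (by omega))
  · refine norm_coeff_mul_le (by positivity) fun i j hij => ?_
    rcases i.eq_zero_or_pos with rfl | hi
    · simp only [coeff_zero_eq_constantCoeff, h.constantCoeff_cocycle, norm_zero, zero_mul]
      positivity
    rw [← hij, ← mul_one (e * mu)]
    exact mul_le_mul_mul_pow hV hemu0 (norm_nonneg _) (hg.norm_coeff_le i) (hS j (by omega))

variable [hp : Fact p.Prime] [CharP K p]

lemma norm_coeff_le (h : IsResonantNormalization p L r g v H) (hL1 : L ≠ 1) (hL : ‖L - 1‖ < 1)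
    (hmu : mu ≤ 1) (hr : CoeffBound (‖L - 1‖ * mu) V r) (hg : CoeffBound (‖L - 1‖ * mu) V g)
    {k : ℕ} (hk : 0 < k) :
    ‖coeff k v‖ ≤ mu * V ^ k ∧ ‖coeff k H‖ ≤ ‖L - 1‖ * mu * V ^ k := by
  have hV := hr.rate_nonneg
  have he : 0 < ‖L - 1‖ := norm_pos_iff.2 (sub_ne_zero.2 hL1)
  have hmu0 : 0 ≤ mu := (mul_nonneg_iff_of_pos_left he).1 hr.nonneg
  induction k using Nat.strong_induction_on with
  | _ k ih =>
    have hdiv := h.norm_small_divisor_le hL hmu hr hg fun j hj hjk => ih j hjk hj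
    by_cases hpk : p ∣ k
    · rw [h.coeff_factor_eq_zero hk hpk, mul_zero, zero_sub, norm_neg] at hdiv
      rw [h.coeff_factor_eq_zero hk hpk, norm_zero]
      exact ⟨by positivity, hdiv⟩
    · rw [h.coeff_eq_zero k hpk, sub_zero, norm_mul, norm_pow_sub_one_of_not_dvd (p := p) hL hpk,
        mul_assoc] at hdiv
      rw [h.coeff_eq_zero k hpk, norm_zero]
      exact ⟨le_of_mul_le_mul_left hdiv he, by positivity⟩

lemma coeffBound_factor (h : IsResonantNormalization p L r g v H) (hL1 : L ≠ 1)
    (hL : ‖L - 1‖ < 1) (hmu : mu ≤ 1) (hr : CoeffBound (‖L - 1‖ * mu) V r)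
    (hg : CoeffBound (‖L - 1‖ * mu) V g) : CoeffBound mu V (v - 1) where
  rate_nonneg := hr.rate_nonneg
  norm_coeff_le k := by
    have he : 0 < ‖L - 1‖ := norm_pos_iff.2 (sub_ne_zero.2 hL1)
    have hmu0 : 0 ≤ mu := (mul_nonneg_iff_of_pos_left he).1 hr.nonneg
    rcases k.eq_zero_or_pos with rfl | hk
    · simpa [h.constantCoeff_factor] using hmu0
    · rw [map_sub, coeff_one, if_neg hk.ne', sub_zero]
      exact (h.norm_coeff_le hL1 hL hmu hr hg hk).1

lemma coeffBound_residue (h : IsResonantNormalization p L r g v H) (hL1 : L ≠ 1)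
    (hL : ‖L - 1‖ < 1) (hmu : mu ≤ 1) (hr : CoeffBound (‖L - 1‖ * mu) V r)
    (hg : CoeffBound (‖L - 1‖ * mu) V g) : CoeffBound (‖L - 1‖ * mu) V H where
  rate_nonneg := hr.rate_nonneg
  norm_coeff_le k := by
    rcases k.eq_zero_or_pos with rfl | hk
    · simpa [h.constantCoeff_residue] using hr.nonneg
    · exact (h.norm_coeff_le hL1 hL hmu hr hg hk).2

lemma norm_coeff_residue_sub_le (h : IsResonantNormalization p L r g v H) (hL1 : L ≠ 1)
    (hL : ‖L - 1‖ < 1) (hmu : mu ≤ 1) (hr : CoeffBound (‖L - 1‖ * mu) V r)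
    (hg : CoeffBound (‖L - 1‖ * mu) V g) {k : ℕ} (hk : 0 < k) (hpk : p ∣ k) :
    ‖coeff k H - coeff k g‖ ≤ ‖L - 1‖ * mu * mu * V ^ k := by
  have hv := h.coeffBound_factor hL1 hL hmu hr hg
  have hH := h.coeffBound_residue hL1 hL hmu hr hg
  have hemu : ‖L - 1‖ * mu ≤ 1 := (mul_le_of_le_one_right (norm_nonneg _) hmu).trans hL.le
  have hLn := norm_eq_one_of_norm_sub_one_lt hL
  have hvk := h.coeff_factor_eq_zero hk hpk
  set S := v.subst (nearLinear L r)
  have hS : CoeffBound mu V (S - 1) := by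
    rw [← subst_nearLinear_sub_one]
    exact hv.subst_nearLinear hLn h.constantCoeff_map hr hemu
  have hsplit : coeff k H - coeff k g =
      coeff k S + coeff k (g * (S - 1)) - coeff k (H * (v - 1)) := by
    have := congrArg (coeff k) (show H - g = S - v + g * (S - 1) - H * (v - 1) by
      linear_combination -h.eqn)
    simpa [hvk] using this
  have hSk : ‖coeff k S‖ ≤ mu * (‖L - 1‖ * mu) * V ^ k := by
    have := norm_coeff_subst_nearLinear_sub_le (a := v) (k := k) hLn h.constantCoeff_map hr hemu
      hv.nonneg fun j hj _ => (h.norm_coeff_le hL1 hL hmu hr hg hj).1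
    rwa [hvk, mul_zero, sub_zero] at this
  rw [hsplit]
  rw [mul_comm mu] at hSk
  exact norm_sub_le_of_norm_le (norm_add_le_of_norm_le hSk ((hg.mul hS).norm_coeff_le k))
    ((hH.mul hv).norm_coeff_le k)

lemma coeffBound_residue_sub_eulerLogDeriv (h : IsResonantNormalization p L r g v H)
    (hL1 : L ≠ 1) (hL : ‖L - 1‖ ≤ th) (hth : th < 1) (hr : CoeffBound (‖L - 1‖ * th) V r)
    (hg : CoeffBound ‖L - 1‖ V g) :
    CoeffBound (‖L - 1‖ * th) V (H - g - C (L - 1) * eulerLogDeriv v) := by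
  have he := norm_nonneg (L - 1)
  have heth : ‖L - 1‖ * th ≤ ‖L - 1‖ := mul_le_of_le_one_right he hth.le
  have hv : CoeffBound 1 V v := (h.coeffBound_factor hL1 (hL.trans_lt hth) le_rfl
    (hr.mono (by rwa [mul_one])) (by rwa [mul_one])).of_sub_one le_rfl
  set S := v.subst (nearLinear L r)
  have hfirst : CoeffBound (‖L - 1‖ * th) V (S - v - C (L - 1) * (X * derivative K v)) := by
    simpa using hv.subst_nearLinear_sub_sub hL hth h.constantCoeff_map hr
  have hder : CoeffBound ‖L - 1‖ V (C (L - 1) * (X * derivative K v)) :=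
    (hv.X_mul_derivative.C_mul (L - 1)).mono (mul_one _).le
  have hSv : CoeffBound ‖L - 1‖ V (S - v) := by
    have := (hfirst.mono heth).add hder
    rwa [sub_add_cancel] at this
  have hlog : eulerLogDeriv v * v = X * derivative K v :=
    eulerLogDeriv_mul_self (by simp [h.constantCoeff_factor])
  refine CoeffBound.of_mul hv (by simp [h.constantCoeff_factor]) ?_
  rw [show v * (H - g - C (L - 1) * eulerLogDeriv v) =
      (S - v - C (L - 1) * (X * derivative K v)) + g * (S - v) by
    linear_combination -h.eqn - C (L - 1) * hlog]
  exact hfirst.add ((hg.mul hSv).mono (by gcongr))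

end IsResonantNormalization

namespace CoeffBound

variable {K : Type*} [NormedField K] {c V : ℝ} {a : K⟦X⟧} {p : ℕ}

lemma decimate (h : CoeffBound c V a) : CoeffBound c (V ^ p) (decimate p a) where
  rate_nonneg := pow_nonneg h.rate_nonneg p
  norm_coeff_le k := by
    rw [coeff_decimate, ← pow_mul]
    exact h.norm_coeff_le _

lemma of_expand {hp0 : p ≠ 0} (h : CoeffBound c V (expand p hp0 a)) : CoeffBound c (V ^ p) a where
  rate_nonneg := pow_nonneg h.rate_nonneg p
  norm_coeff_le k := by
    rw [← coeff_expand_mul p hp0, ← pow_mul]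
    exact h.norm_coeff_le _

lemma map_frobenius [Fact p.Prime] [CharP K p] (h : CoeffBound c V a) :
    CoeffBound (c ^ p) (V ^ p) (map (frobenius K p) a) where
  rate_nonneg := pow_nonneg h.rate_nonneg p
  norm_coeff_le k := by
    rw [coeff_map, frobenius_def, norm_pow, pow_right_comm, ← mul_pow]
    exact pow_le_pow_left₀ (norm_nonneg _) (h.norm_coeff_le k) p

end CoeffBound

section LowDegree

variable {K : Type*} [Field K] {L : K} {r g u : K⟦X⟧}

lemma IsCohomologicalSolution.sub_one_mul_coeff_one (h : IsCohomologicalSolution L r g u) :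
    (L - 1) * coeff 1 u = -coeff 1 g := by
  have hsub := coeff_subst_nearLinear_sub (L := L) h.constantCoeff_map u 1
  have heqn := congrArg (coeff 1) h.eqn
  rw [mul_add, mul_one, map_add, coeff_mul,
    Finset.Nat.sum_antidiagonal_eq_sum_range_succ_mk] at heqn
  simp only [Finset.sum_range_succ, Finset.sum_range_zero, coeff_zero_eq_constantCoeff,
    constantCoeff_subst_nearLinear, h.constantCoeff_sol, h.constantCoeff_cocycle, pow_zero,
    sub_self, Nat.sub_self, map_zero, mul_zero, Nat.sub_zero, zero_add, one_mul, add_zero,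
    pow_one] at hsub heqn
  linear_combination heqn - hsub

lemma IsCohomologicalSolution.sq_sub_one_mul_coeff_two (h : IsCohomologicalSolution L r g u) :
    (L ^ 2 - 1) * coeff 2 u = -(L * coeff 1 u * (coeff 1 r + coeff 1 g) + coeff 2 g) := by
  have hsub₁ := coeff_subst_nearLinear_sub (L := L) h.constantCoeff_map u 1
  have hsub := coeff_subst_nearLinear_sub (L := L) h.constantCoeff_map u 2
  have heqn := congrArg (coeff 2) h.eqn
  rw [mul_add, mul_one, map_add, coeff_mul,
    Finset.Nat.sum_antidiagonal_eq_sum_range_succ_mk] at heqn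
  simp only [Finset.sum_range_succ, Finset.sum_range_zero, coeff_zero_eq_constantCoeff,
    constantCoeff_subst_nearLinear, h.constantCoeff_sol, h.constantCoeff_cocycle, pow_zero,
    sub_self, map_zero, mul_zero, Nat.sub_zero, zero_add, one_mul, add_zero, pow_one,
    add_sub_cancel_left, Nat.reduceSub] at hsub₁ hsub heqn
  linear_combination heqn - hsub - coeff 1 g * hsub₁

end LowDegree

section Domination

variable {K : Type*} [NormedField K]

/-- At scale `V` the cocycle `1 + g` over `nearLinear L r` is dominated by its coefficients of
degree `1` and `2`: `g` has size `‖L - 1‖`, attained in one of these degrees, while `r` and the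
higher terms of `g` are smaller by the factor `th`. -/
structure IsLowDegreeDominated (th V : ℝ) (L : K) (r g : K⟦X⟧) : Prop where
  ne_one : L ≠ 1
  norm_sub_one_le : ‖L - 1‖ ≤ th
  rate_pos : 0 < V
  coeffBound_map : CoeffBound (‖L - 1‖ * th) V r
  coeffBound_cocycle : CoeffBound ‖L - 1‖ V g
  norm_coeff_tail : ∀ k, 3 ≤ k → ‖coeff k g‖ ≤ ‖L - 1‖ * th * V ^ k
  norm_eq : ‖coeff 1 g‖ = ‖L - 1‖ * V ∨ ‖coeff 2 g‖ = ‖L - 1‖ * V ^ 2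

lemma exists_sq_max {x y : ℝ} (hx : 0 ≤ x) (hy : 0 ≤ y) :
    ∃ W : ℝ, 0 ≤ W ∧ x ≤ W ∧ y ≤ W ^ 2 ∧ (x = W ∨ y = W ^ 2) := by
  refine ⟨max x √y, le_max_of_le_left hx, le_max_left _ _,
    (Real.sqrt_le_left (le_max_of_le_left hx)).1 (le_max_right _ _), ?_⟩
  rcases le_total x √y with h | h
  · exact .inr (by rw [max_eq_right h, Real.sq_sqrt hy])
  · exact .inl (by rw [max_eq_left h])

namespace IsLowDegreeDominated

variable {th c q V D : ℝ} {L : K} {r g u : K⟦X⟧}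

lemma exists_of_coeffBound (hL1 : L ≠ 1) (hL : ‖L - 1‖ ≤ th) (hth : th ≤ 1)
    (hg0 : constantCoeff g = 0) (hq : 0 < q) (hr : CoeffBound (‖L - 1‖ * th) q r)
    (hg : CoeffBound c q g)
    (hscale : ∀ W, 0 ≤ W → ‖coeff 1 g‖ ≤ ‖L - 1‖ * W → ‖coeff 2 g‖ ≤ ‖L - 1‖ * W ^ 2 →
      q ≤ W ∧ c * q ^ 3 ≤ ‖L - 1‖ * th * W ^ 3) :
    ∃ W, IsLowDegreeDominated th W L r g := by
  have he : 0 < ‖L - 1‖ := norm_pos_iff.2 (sub_ne_zero.2 hL1)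
  have hth0 : 0 ≤ th := he.le.trans hL
  obtain ⟨W, hW0, hW1, hW2, hW⟩ := exists_sq_max (x := ‖coeff 1 g‖ / ‖L - 1‖)
    (y := ‖coeff 2 g‖ / ‖L - 1‖) (by positivity) (by positivity)
  rw [div_le_iff₀' he] at hW1 hW2
  rw [div_eq_iff he.ne', div_eq_iff he.ne', mul_comm W, mul_comm (W ^ 2)] at hW
  obtain ⟨hqW, hcube⟩ := hscale W hW0 hW1 hW2
  have htail (k : ℕ) (hk : 3 ≤ k) : ‖coeff k g‖ ≤ ‖L - 1‖ * th * W ^ k := by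
    obtain ⟨m, rfl⟩ := Nat.exists_eq_add_of_le hk
    calc ‖coeff (3 + m) g‖ ≤ c * q ^ 3 * q ^ m := by
          rw [mul_assoc, ← pow_add]; exact hg.norm_coeff_le _
      _ ≤ ‖L - 1‖ * th * W ^ 3 * W ^ m := by gcongr
      _ = ‖L - 1‖ * th * W ^ (3 + m) := by rw [pow_add, mul_assoc]
  refine ⟨W, hL1, hL, hq.trans_le hqW, hr.mono_rate hqW, ⟨hW0, fun k => ?_⟩, htail, hW⟩
  rcases lt_or_ge k 3 with hk | hk
  · interval_cases k
    · rw [coeff_zero_eq_constantCoeff_apply, hg0, norm_zero]; positivity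
    · rwa [pow_one]
    · exact hW2
  · exact (htail k hk).trans (by gcongr; exact mul_le_of_le_one_right he.le hth)

lemma norm_sub_one_pos (h : IsLowDegreeDominated th V L r g) : 0 < ‖L - 1‖ :=
  norm_pos_iff.2 (sub_ne_zero.2 h.ne_one)

variable {p : ℕ} [hp : Fact p.Prime] [CharP K p] {v G H : K⟦X⟧}

lemma exists_map_frobenius (hL1 : L ≠ 1) (hL : ‖L - 1‖ ≤ th) (hth : th < 1) (hV : 0 < V)
    (hr : CoeffBound (‖L - 1‖ * th) V r) (hG0 : constantCoeff G = 0)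
    (hG : CoeffBound c V (expand p hp.out.ne_zero G))
    (hscale : ∀ W, 0 ≤ W → ‖coeff 1 G‖ ≤ ‖L ^ p - 1‖ * W → ‖coeff 2 G‖ ≤ ‖L ^ p - 1‖ * W ^ 2 →
      V ^ p ≤ W ∧ c * (V ^ p) ^ 3 ≤ ‖L ^ p - 1‖ * th * W ^ 3) :
    ∃ W, IsLowDegreeDominated th W (L ^ p) (map (frobenius K p) r) G := by
  have he : 0 < ‖L - 1‖ := norm_pos_iff.2 (sub_ne_zero.2 hL1)
  have hLp := norm_pow_char_sub_one (p := p) L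
  refine exists_of_coeffBound ?_ ?_ hth.le hG0 (by positivity) ?_ hG.of_expand hscale
  · rw [← sub_ne_zero, ← norm_pos_iff, hLp]
    positivity
  · rw [hLp]
    exact (pow_le_of_le_one he.le (hL.trans hth.le) hp.out.ne_zero).trans hL
  · refine hr.map_frobenius.mono ?_
    rw [mul_pow, hLp]
    gcongr
    exact pow_le_of_le_one (he.le.trans hL) hth.le hp.out.ne_zero

variable [IsUltrametricDist K]

theorem rate_le (h : IsLowDegreeDominated th V L r g) (hp2 : p ≠ 2) (hth : th < 1)
    (hu : IsCohomologicalSolution L r g u) (hD : CoeffBound 1 D u) : V ≤ D := by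
  by_contra! hDV
  have he := h.norm_sub_one_pos
  have hL := h.norm_sub_one_le.trans_lt hth
  have hV := h.rate_pos
  have hD0 := hD.rate_nonneg
  have hu1 : ‖coeff 1 u‖ ≤ D := by simpa using hD.norm_coeff_le 1
  have hu2 : ‖coeff 2 u‖ ≤ D ^ 2 := by simpa using hD.norm_coeff_le 2
  rcases h.norm_eq with hg1 | hg2
  · rw [← norm_neg, ← hu.sub_one_mul_coeff_one, norm_mul] at hg1
    exact (hu1.trans_lt hDV).ne (mul_left_cancel₀ he.ne' hg1)
  · have hp2' : ¬ p ∣ 2 := fun hd =>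
      hp2 ((Nat.prime_dvd_prime_iff_eq hp.out Nat.prime_two).1 hd)
    have hrg : ‖coeff 1 r + coeff 1 g‖ ≤ ‖L - 1‖ * V := by
      simpa using ((h.coeffBound_map.mono (mul_le_of_le_one_right he.le hth.le)).add
        h.coeffBound_cocycle).norm_coeff_le 1
    have hsol : coeff 2 g =
        -((L ^ 2 - 1) * coeff 2 u) - L * coeff 1 u * (coeff 1 r + coeff 1 g) := by
      linear_combination hu.sq_sub_one_mul_coeff_two
    refine absurd hg2 (ne_of_lt (lt_of_le_of_lt (b := ‖L - 1‖ * (D * V)) ?_ ?_))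
    · rw [hsol]
      refine norm_sub_le_of_norm_le ?_ ?_
      · rw [norm_neg, norm_mul, norm_pow_sub_one_of_not_dvd (p := p) hL hp2']
        gcongr
        exact hu2.trans (by rw [pow_two]; gcongr)
      · rw [norm_mul, norm_mul, norm_eq_one_of_norm_sub_one_lt hL, one_mul, mul_left_comm]
        gcongr
    · rw [pow_two]
      gcongr

lemma coeffBound_residue (h : IsLowDegreeDominated th V L r g) (hth : th < 1)
    (hv : IsResonantNormalization p L r g v H) : CoeffBound ‖L - 1‖ V H := by
  simpa using hv.coeffBound_residue (mu := 1) h.ne_one (h.norm_sub_one_le.trans_lt hth) le_rfl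
    (h.coeffBound_map.mono (by gcongr)) (by simpa using h.coeffBound_cocycle)

/-- Since the degree `k` is not resonant, `g` is cancelled there by `(L - 1)` times the logarithmic
derivative of `v`, whose coefficients of degree `k` and `p * k` are related by Frobenius. -/
lemma norm_coeff_residue_eq (h : IsLowDegreeDominated th V L r g) (hth : th < 1)
    (hv : IsResonantNormalization p L r g v H) {k : ℕ} (hpk : ¬ p ∣ k) (hpk3 : 3 ≤ p * k)
    (hg : ‖coeff k g‖ = ‖L - 1‖ * V ^ k) : ‖coeff (p * k) H‖ = ‖L - 1‖ * V ^ (p * k) := by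
  have he := h.norm_sub_one_pos
  have hV := h.rate_pos
  have hsmall (j : ℕ) : ‖L - 1‖ * th * V ^ j < ‖L - 1‖ * V ^ j := by
    gcongr
    exact mul_lt_of_lt_one_right he hth
  set l := eulerLogDeriv v
  have hfirst (j : ℕ) :
      ‖coeff j H - coeff j g - (L - 1) * coeff j l‖ ≤ ‖L - 1‖ * th * V ^ j := by
    rw [← coeff_C_mul, ← map_sub, ← map_sub]
    exact (hv.coeffBound_residue_sub_eulerLogDeriv h.ne_one h.norm_sub_one_le hth
      h.coeffBound_map h.coeffBound_cocycle).norm_coeff_le j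
  have hlk : ‖coeff k l‖ = V ^ k := by
    refine mul_left_cancel₀ he.ne' ?_
    rw [← norm_mul, ← hg, ← norm_neg (coeff k g)]
    refine norm_eq_of_norm_sub_lt ?_
    rw [norm_sub_rev, norm_neg, hg]
    simpa [hv.coeff_eq_zero k hpk] using (hfirst k).trans_lt (hsmall k)
  have hlpk : ‖(L - 1) * coeff (p * k) l‖ = ‖L - 1‖ * V ^ (p * k) := by
    rw [norm_mul, mem_cartierFixed.1 (eulerLogDeriv_mem_cartierFixed hv.constantCoeff_factor),
      norm_pow, hlk, ← pow_mul, mul_comm k p]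
  rw [← hlpk]
  refine norm_eq_of_norm_sub_lt ?_
  rw [show coeff (p * k) H - (L - 1) * coeff (p * k) l =
    (coeff (p * k) H - coeff (p * k) g - (L - 1) * coeff (p * k) l) + coeff (p * k) g by ring,
    hlpk]
  exact (norm_add_le_of_norm_le (hfirst _) (h.norm_coeff_tail _ hpk3)).trans_lt (hsmall _)

variable {s : ℕ}

lemma rate_pow_le (h : IsLowDegreeDominated th V L r g) (hth : th < 1) (hs : p = 2 * s + 1)
    (hv : IsResonantNormalization p L r g v (expand p hp.out.ne_zero G)) {W : ℝ} (hW : 0 ≤ W)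
    (hG1 : ‖coeff 1 G‖ ≤ ‖L ^ p - 1‖ * W) (hG2 : ‖coeff 2 G‖ ≤ ‖L ^ p - 1‖ * W ^ 2) :
    V ^ p ≤ ‖L - 1‖ ^ s * W := by
  have he := h.norm_sub_one_pos
  have hp1 := hp.out.one_lt
  have hndvd {k : ℕ} (hk : 0 < k) (hkp : k < p) : ¬ p ∣ k := fun hd =>
    (Nat.le_of_dvd hk hd).not_gt hkp
  have hpe : ‖L - 1‖ ^ p = ‖L - 1‖ * (‖L - 1‖ ^ s) ^ 2 := by
    rw [hs, ← pow_mul, mul_comm s 2, pow_succ']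
  rw [norm_pow_char_sub_one, hpe, mul_assoc] at hG1 hG2
  rw [← coeff_expand_mul p hp.out.ne_zero] at hG1 hG2
  rcases h.norm_eq with hg | hg
  · rw [h.norm_coeff_residue_eq hth hv (hndvd one_pos hp1) (by omega) (by simpa using hg),
      mul_one] at hG1
    refine (le_of_mul_le_mul_left hG1 he).trans ?_
    gcongr
    exact pow_le_of_le_one (by positivity)
      (pow_le_one₀ he.le (h.norm_sub_one_le.trans hth.le)) two_ne_zero
  · rw [h.norm_coeff_residue_eq hth hv (hndvd two_pos (by omega)) (by omega) hg, pow_mul,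
      ← mul_pow] at hG2
    exact (pow_le_pow_iff_left₀ (by have := h.rate_pos; positivity) (by positivity)
      two_ne_zero).1 (le_of_mul_le_mul_left hG2 he)

lemma renormalize (h : IsLowDegreeDominated th V L r g) (hth : th < 1) (hs : p = 2 * s + 1)
    (hv : IsResonantNormalization p L r g v (expand p hp.out.ne_zero G)) :
    ∃ W, IsLowDegreeDominated th W (L ^ p) (map (frobenius K p) r) G := by
  have he := h.norm_sub_one_pos
  have hV := h.rate_pos
  have he1 : ‖L - 1‖ ≤ 1 := h.norm_sub_one_le.trans hth.le
  have hs0 : s ≠ 0 := by rintro rfl; exact hp.out.one_lt.ne' hs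
  have hLp := norm_pow_char_sub_one (p := p) L
  refine exists_map_frobenius h.ne_one h.norm_sub_one_le hth hV h.coeffBound_map
    (by simpa using hv.constantCoeff_residue) (h.coeffBound_residue hth hv) fun W hW hG1 hG2 => ?_
  have hVW := h.rate_pow_le hth hs hv hW hG1 hG2
  refine ⟨hVW.trans (mul_le_of_le_one_left hW (pow_le_one₀ he.le he1)), ?_⟩
  calc ‖L - 1‖ * (V ^ p) ^ 3 ≤ ‖L - 1‖ * (‖L - 1‖ ^ s * W) ^ 3 := by gcongr
    _ = ‖L - 1‖ ^ p * ‖L - 1‖ ^ s * W ^ 3 := by rw [hs]; ring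
    _ ≤ ‖L ^ p - 1‖ * th * W ^ 3 := by
      rw [hLp]
      gcongr
      exact (pow_le_of_le_one he.le he1 hs0).trans h.norm_sub_one_le

theorem rate_pow_le_mul (h : IsLowDegreeDominated th V L r g) (hth : th < 1)
    (hs : p = 2 * s + 1) (hu : IsCohomologicalSolution L r g u) (hD : CoeffBound 1 D u) (n : ℕ) :
    V ^ p ≤ ‖L - 1‖ ^ n * D ^ p := by
  induction n generalizing V L r g u D with
  | zero =>
    rw [pow_zero, one_mul]
    exact pow_le_pow_left₀ h.rate_pos.le (h.rate_le (by omega) hth hu hD) p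
  | succ n ih =>
    have he := h.norm_sub_one_pos
    have hV := h.rate_pos
    have hD0 := hD.rate_nonneg
    have hs0 : s ≠ 0 := by rintro rfl; exact hp.out.one_lt.ne' hs
    obtain ⟨v, G, hv, hU⟩ := hu.exists_renormalization (p := p)
    obtain ⟨W, hG⟩ := h.renormalize hth hs hv
    have hW := hG.rate_pos
    have hVW : V ^ p ≤ ‖L - 1‖ * W := by
      refine (h.rate_pow_le hth hs hv hW.le (by simpa using hG.coeffBound_cocycle.norm_coeff_le 1)
        (hG.coeffBound_cocycle.norm_coeff_le 2)).trans ?_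
      gcongr
      exact pow_le_of_le_one he.le (h.norm_sub_one_le.trans hth.le) hs0
    refine (pow_le_pow_iff_left₀ (by positivity) (by positivity) hp.out.ne_zero).1 ?_
    calc (V ^ p) ^ p ≤ (‖L - 1‖ * W) ^ p := by gcongr
      _ = ‖L - 1‖ ^ p * W ^ p := mul_pow _ _ _
      _ ≤ ‖L - 1‖ ^ p * (‖L ^ p - 1‖ ^ n * (D ^ p) ^ p) := by
        gcongr
        exact ih hG hU hD.decimate
      _ = (‖L - 1‖ ^ (n + 1) * D ^ p) ^ p := by rw [norm_pow_char_sub_one]; ring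

theorem not_coeffBound (h : IsLowDegreeDominated th V L r g) (hp2 : p ≠ 2) (hth : th < 1)
    (hu : IsCohomologicalSolution L r g u) : ¬ CoeffBound 1 D u := by
  intro hD
  obtain ⟨s, hs⟩ := hp.out.odd_of_ne_two hp2
  have hV := h.rate_pos
  have hD0 : 0 < D := hV.trans_le (h.rate_le hp2 hth hu hD)
  obtain ⟨n, hn⟩ := exists_pow_lt_of_lt_one (show 0 < V ^ p / D ^ p by positivity)
    (h.norm_sub_one_le.trans_lt hth)
  rw [lt_div_iff₀ (by positivity)] at hn
  exact hn.not_ge (h.rate_pow_le_mul hth hs hu hD n)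

end IsLowDegreeDominated

end Domination

section Divergence

variable {K : Type*} [NormedField K] [IsUltrametricDist K] {p : ℕ} [hp : Fact p.Prime] [CharP K p]
  {L : K} {r u v G H : K⟦X⟧} {mu V D W : ℝ}

lemma IsResonantNormalization.norm_coeff_residue_eq (h : IsResonantNormalization p L r r v H)
    (hL1 : L ≠ 1) (hL : ‖L - 1‖ ≤ mu) (hmu : mu < 1) (hV : 0 < V)
    (hr : CoeffBound (‖L - 1‖ * mu) V r) {k : ℕ} (hk : 0 < k) (hpk : p ∣ k)
    (hrk : ‖coeff k r‖ = ‖L - 1‖ * mu * V ^ k) : ‖coeff k H‖ = ‖L - 1‖ * mu * V ^ k := by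
  have he : 0 < ‖L - 1‖ := norm_pos_iff.2 (sub_ne_zero.2 hL1)
  have hmu0 : 0 < mu := he.trans_le hL
  rw [← hrk]
  refine norm_eq_of_norm_sub_lt
    ((h.norm_coeff_residue_sub_le hL1 (hL.trans_lt hmu) hmu.le hr hr hk hpk).trans_lt ?_)
  rw [hrk]
  gcongr
  exact mul_lt_of_lt_one_right (by positivity) hmu

lemma IsResonantNormalization.sq_rate_pow_le
    (h : IsResonantNormalization p L r r v (expand p hp.out.ne_zero G))
    (hL1 : L ≠ 1) (hL : ‖L - 1‖ ≤ mu) (hmu : mu < 1) (hV : 0 < V)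
    (hr : CoeffBound (‖L - 1‖ * mu) V r)
    (hdom : ‖coeff p r‖ = ‖L - 1‖ * mu * V ^ p ∨
      ‖coeff (p * 2) r‖ = ‖L - 1‖ * mu * V ^ (p * 2) ∧ mu = ‖L - 1‖)
    (hG1 : ‖coeff 1 G‖ ≤ ‖L ^ p - 1‖ * W) (hG2 : ‖coeff 2 G‖ ≤ ‖L ^ p - 1‖ * W ^ 2)
    {t : ℕ} (ht : p = 2 * t + 5) : (V ^ p) ^ 2 ≤ ‖L - 1‖ ^ (2 * t + 3) * W ^ 2 := by
  have he : 0 < ‖L - 1‖ := norm_pos_iff.2 (sub_ne_zero.2 hL1)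
  have hLp : ‖L ^ p - 1‖ = ‖L - 1‖ ^ 2 * ‖L - 1‖ ^ (2 * t + 3) := by
    rw [norm_pow_char_sub_one, ← pow_add]
    congr 1
    omega
  have hp0 := hp.out.pos
  rw [← coeff_expand_mul p hp.out.ne_zero, hLp, mul_assoc] at hG1 hG2
  rcases hdom with hdom | ⟨hdom, hmue⟩
  · rw [mul_one, h.norm_coeff_residue_eq hL1 hL hmu hV hr hp0 dvd_rfl hdom] at hG1
    have hVW : V ^ p ≤ ‖L - 1‖ ^ (2 * t + 3) * W := by
      refine le_of_mul_le_mul_left (le_trans ?_ hG1) (sq_pos_of_pos he)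
      rw [pow_two]
      gcongr
    calc (V ^ p) ^ 2 ≤ (‖L - 1‖ ^ (2 * t + 3)) ^ 2 * W ^ 2 := by rw [← mul_pow]; gcongr
      _ ≤ ‖L - 1‖ ^ (2 * t + 3) * W ^ 2 := by
        gcongr
        exact pow_le_of_le_one (by positivity) (pow_le_one₀ he.le (hL.trans hmu.le)) two_ne_zero
  · rw [h.norm_coeff_residue_eq hL1 hL hmu hV hr (by omega) (dvd_mul_right p 2) hdom, hmue,
      ← pow_two, pow_mul] at hG2
    exact le_of_mul_le_mul_left hG2 (sq_pos_of_pos he)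

theorem IsCohomologicalSolution.not_coeffBound (hu : IsCohomologicalSolution L r r u)
    (hp5 : 5 ≤ p) (hL1 : L ≠ 1) (hL : ‖L - 1‖ ≤ mu) (hmu : mu < 1) (hV : 0 < V)
    (hr : CoeffBound (‖L - 1‖ * mu) V r)
    (hdom : ‖coeff p r‖ = ‖L - 1‖ * mu * V ^ p ∨
      ‖coeff (p * 2) r‖ = ‖L - 1‖ * mu * V ^ (p * 2) ∧ mu = ‖L - 1‖) : ¬ CoeffBound 1 D u := by
  intro hD
  have he : 0 < ‖L - 1‖ := norm_pos_iff.2 (sub_ne_zero.2 hL1)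
  have hmu0 : 0 < mu := he.trans_le hL
  have he1 : ‖L - 1‖ < 1 := hL.trans_lt hmu
  have hLp := norm_pow_char_sub_one (p := p) L
  obtain ⟨t, ht⟩ : ∃ t, p = 2 * t + 5 := by
    obtain ⟨s, hs⟩ := hp.out.odd_of_ne_two (by omega)
    exact ⟨s - 2, by omega⟩
  obtain ⟨v, G, hv, hU⟩ := hu.exists_renormalization (p := p)
  obtain ⟨W, hG⟩ : ∃ W, IsLowDegreeDominated mu W (L ^ p) (map (frobenius K p) r) G := by
    refine IsLowDegreeDominated.exists_map_frobenius hL1 hL hmu hV hr hU.constantCoeff_cocycle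
      (hv.coeffBound_residue hL1 he1 hmu.le hr hr) fun W hW hG1 hG2 => ?_
    have hsq := hv.sq_rate_pow_le hL1 hL hmu hV hr hdom hG1 hG2 ht
    have hVW : V ^ p ≤ ‖L - 1‖ ^ (t + 1) * W := by
      refine (pow_le_pow_iff_left₀ (by positivity) (by positivity) two_ne_zero).1
        (hsq.trans ?_)
      rw [mul_pow, ← pow_mul]
      exact mul_le_mul_of_nonneg_right (pow_le_pow_of_le_one he.le he1.le (by omega))
        (by positivity)
    refine ⟨hVW.trans (mul_le_of_le_one_left hW (pow_le_one₀ he.le he1.le)), ?_⟩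
    calc ‖L - 1‖ * mu * (V ^ p) ^ 3 = ‖L - 1‖ * mu * (V ^ p * (V ^ p) ^ 2) := by ring
      _ ≤ ‖L - 1‖ * mu * ((‖L - 1‖ ^ (t + 1) * W) * (‖L - 1‖ ^ (2 * t + 3) * W ^ 2)) := by
        gcongr
      _ = ‖L - 1‖ ^ p * ‖L - 1‖ ^ t * mu * W ^ 3 := by rw [ht]; ring
      _ ≤ ‖L ^ p - 1‖ * mu * W ^ 3 := by
        rw [hLp]
        gcongr
        exact mul_le_of_le_one_right (by positivity) (pow_le_one₀ he.le he1.le)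
  exact hG.not_coeffBound (by omega) hmu hU hD.decimate

end Divergence

section Conjugacy

variable {K : Type*} [Field K] {L : K} {f g h r t : K⟦X⟧}

lemma coeff_one_subst_nearLinear (hr0 : constantCoeff r = 0) (a : K⟦X⟧) :
    coeff 1 (a.subst (nearLinear L r)) = L * coeff 1 a := by
  have := coeff_subst_nearLinear_sub (L := L) hr0 a 1
  simp only [Finset.sum_range_one, pow_zero, sub_self, map_zero, mul_zero, pow_one] at this
  exact sub_eq_zero.1 this

lemma exists_eq_nearLinear (hL : L ≠ 0) (h0 : constantCoeff g = 0) (h1 : coeff 1 g = L) :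
    ∃ r, constantCoeff r = 0 ∧ g = nearLinear L r := by
  obtain ⟨d, rfl⟩ := X_dvd_iff.2 h0
  have hd : constantCoeff d = L := by simpa [coeff_succ_X_mul] using h1
  have hC : C L * C L⁻¹ = (1 : K⟦X⟧) := by rw [← map_mul, mul_inv_cancel₀ hL, map_one]
  refine ⟨C L⁻¹ * d - 1, by simp [hd, hL], ?_⟩
  rw [nearLinear]
  linear_combination -(X * d) * hC

lemma exists_subst_nearLinear_eq (hL : L ≠ 0) (ht0 : constantCoeff t = 0)
    (h0 : constantCoeff g = 0) (h1 : coeff 1 g = L) :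
    ∃ r, constantCoeff r = 0 ∧ (nearLinear 1 t).subst (nearLinear L r) = g := by
  obtain ⟨s, hs0, rfl⟩ := exists_eq_nearLinear hL h0 h1
  have hpsi0 : constantCoeff (nearLinear 1 t) = 0 := by simp [nearLinear]
  have hpsi1 : coeff 1 (nearLinear 1 t) = 1 := by simp [nearLinear, coeff_succ_X_mul, ht0]
  have hunit : IsUnit (coeff 1 (nearLinear 1 t)) := by
    rw [hpsi1]
    exact isUnit_one
  set q := (nearLinear 1 t).substInvOfIsUnit hunit with hq
  have hq0 : constantCoeff q = 0 := constantCoeff_substInvOfIsUnit _ hunit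
  have hq1 : coeff 1 q = 1 := by
    rw [hq, coeff_one_substInvOfIsUnit, show hunit.unit = 1 from Units.ext hpsi1, inv_one,
      Units.val_one]
  obtain ⟨r, hr0, hr⟩ := exists_eq_nearLinear (g := q.subst (nearLinear L s)) hL
    (by rw [constantCoeff_subst_nearLinear, hq0])
    (by rw [coeff_one_subst_nearLinear hs0, hq1, mul_one])
  refine ⟨r, hr0, ?_⟩
  rw [← hr, ← subst_comp_subst_apply (HasSubst.substInvOfIsUnit _ hunit)
    (hasSubst_nearLinear L s), subst_substInvOfIsUnit_right _ hpsi0 hunit,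
    subst_X (hasSubst_nearLinear L s)]

lemma subst_linearization (hf0 : constantCoeff f = 0) (hlin : h.subst f = C L * h)
    (hconj : (nearLinear 1 t).subst (nearLinear L r) = f.subst (nearLinear 1 t)) :
    PowerSeries.subst (nearLinear L r) (h.subst (nearLinear 1 t) : K⟦X⟧) =
      C L * h.subst (nearLinear 1 t) := by
  have hpsi := hasSubst_nearLinear 1 t
  rw [subst_comp_subst_apply hpsi (hasSubst_nearLinear L r), hconj,
    ← subst_comp_subst_apply (HasSubst.of_constantCoeff_zero' hf0) hpsi, hlin, subst_mul hpsi,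
    subst_C]
  rfl

lemma IsCohomologicalSolution.of_subst_eq {b : K} (hL : L ≠ 0) (hb : b ≠ 0)
    (hr0 : constantCoeff r = 0) (ht0 : constantCoeff t = 0)
    (heqn : (nearLinear b t).subst (nearLinear L r) = C L * nearLinear b t) :
    IsCohomologicalSolution L r r (1 + t) := by
  refine ⟨hr0, by simp [ht0], mul_left_cancel₀ (a := C b * C L * X) ?_ ?_⟩
  · exact mul_ne_zero (mul_ne_zero ((map_ne_zero_iff _ C_injective).2 hb)
      ((map_ne_zero_iff _ C_injective).2 hL)) X_ne_zero
  · have hT := hasSubst_nearLinear L r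
    rw [show nearLinear b t = C b * X * (1 + t) from rfl, subst_mul hT, subst_mul hT, subst_X hT,
      subst_C] at heqn
    change C b * (C L * X * (1 + r)) * _ = _ at heqn
    linear_combination heqn

end Conjugacy

section Linearizable

variable {K : Type*} [NormedField K] {x L : K} {c V D : ℝ} {f h r t a : K⟦X⟧}

lemma CoeffBound.exists_rate (ha : CoeffBound c V a) (ha0 : ‖constantCoeff a‖ ≤ 1) :
    ∃ D, CoeffBound 1 D a := by
  have hV := ha.rate_nonneg
  refine ⟨max 1 c * V, by positivity, fun k => ?_⟩
  rcases k.eq_zero_or_pos with rfl | hk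
  · simpa using ha0
  · rw [one_mul, mul_pow]
    refine (ha.norm_coeff_le k).trans ?_
    gcongr
    exact (le_max_right 1 c).trans (le_self_pow₀ (le_max_left 1 c) hk.ne')

lemma exists_coeffBound_of_isLocallyAnalytic (hh : IsLocallyAnalytic h) (hx0 : x ≠ 0)
    (hx : ‖x‖ < 1) : ∃ c D, CoeffBound c D h := by
  obtain ⟨ρ, hρ, hsum⟩ := hh
  obtain ⟨n, hn⟩ := exists_pow_lt_of_lt_one hρ hx
  have hpos : 0 < ‖x ^ n‖ := norm_pos_iff.2 (pow_ne_zero n hx0)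
  obtain ⟨M, hM⟩ := (hsum (x ^ n) (by rwa [norm_pow])).tendsto_atTop_zero.norm.bddAbove_range
  refine ⟨M, ‖x ^ n‖⁻¹, by positivity, fun k => ?_⟩
  rw [inv_pow, ← div_eq_mul_inv, le_div_iff₀ (by positivity), ← norm_pow, ← norm_mul]
  exact hM ⟨k, rfl⟩

lemma exists_linearization_of_isLocallyLinearizable (hf : IsLocallyLinearizable f) :
    ∃ h : K⟦X⟧, constantCoeff h = 0 ∧ coeff 1 h ≠ 0 ∧ IsLocallyAnalytic h ∧
      h.subst f = C (coeff 1 f) * h := by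
  obtain ⟨h, hb, h0, han, heqn⟩ := hf
  have hh := HasSubst.of_constantCoeff_zero' h0
  refine ⟨h, h0, hb.ne_zero, han, ?_⟩
  have hsubst := congrArg (fun a : K⟦X⟧ => a.subst h) heqn
  beta_reduce at hsubst
  rw [subst_comp_subst_apply (HasSubst.substInvOfIsUnit h hb) hh,
    subst_substInvOfIsUnit_left h h0 hb, X_subst, subst_mul hh, subst_C, subst_X hh] at hsubst
  exact hsubst

variable [IsUltrametricDist K]

theorem exists_isCohomologicalSolution (hf : IsLocallyLinearizable f) (hf0 : constantCoeff f = 0)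
    (hf1 : coeff 1 f = L) (hL : L ≠ 0) (hx0 : x ≠ 0) (hx : ‖x‖ < 1)
    (hr0 : constantCoeff r = 0) (ht0 : constantCoeff t = 0) (ht : CoeffBound 1 V t)
    (hconj : (nearLinear 1 t).subst (nearLinear L r) = f.subst (nearLinear 1 t)) :
    ∃ u D, IsCohomologicalSolution L r r u ∧ CoeffBound 1 D u := by
  obtain ⟨h, h0, h1, han, hlin⟩ := exists_linearization_of_isLocallyLinearizable hf
  rw [hf1] at hlin
  obtain ⟨c, D, hD⟩ := exists_coeffBound_of_isLocallyAnalytic han hx0 hx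
  set H : K⟦X⟧ := h.subst (nearLinear 1 t) with hH
  have hHbound : CoeffBound c (max D V) H :=
    (hD.mono_rate (le_max_left D V)).subst_nearLinear norm_one ht0
      (ht.mono_rate (le_max_right D V)) le_rfl
  obtain ⟨s, hs0, hs⟩ := exists_eq_nearLinear (g := H) h1
    (by rw [hH, constantCoeff_subst_nearLinear, h0])
    (by rw [hH, coeff_one_subst_nearLinear ht0, one_mul])
  have hsol : IsCohomologicalSolution L r r (1 + s) :=
    .of_subst_eq hL h1 hr0 hs0 (hs ▸ subst_linearization hf0 hlin hconj)
  have hu : CoeffBound (c * max D V / ‖coeff 1 h‖) (max D V) (1 + s) := by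
    refine ⟨hHbound.rate_nonneg, fun k => ?_⟩
    have hcoeff : coeff (k + 1) H = coeff 1 h * coeff k (1 + s) := by
      rw [hs, nearLinear, mul_assoc, coeff_C_mul, coeff_succ_X_mul]
    rw [div_mul_eq_mul_div, le_div_iff₀' (norm_pos_iff.2 h1), ← norm_mul, ← hcoeff, mul_assoc,
      ← pow_succ']
    exact hHbound.norm_coeff_le (k + 1)
  obtain ⟨D', hD'⟩ := hu.exists_rate (by rw [hsol.constantCoeff_sol, norm_one])
  exact ⟨1 + s, D', hsol, hD'⟩

end Linearizable

section Cubic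

variable {K : Type*} [Field K] {L α β γ ε : K} {n : ℕ} {b r φ : K⟦X⟧}

/-- The polynomial `(1 + ε) X + ε α X ^ 2 + ε β X ^ 3`. The two nonlinear coefficients are
normalized by `ε`, the distance of the multiplier from `1`. -/
noncomputable def cubic (ε α β : K) : K⟦X⟧ :=
  C (1 + ε) * X + C (ε * α) * X ^ 2 + C (ε * β) * X ^ 3

/-- The relative displacement of `cubic ε α β` in the coordinate `X * φ`, divided by `ε`. -/
noncomputable def displacement (α β : K) (φ : K⟦X⟧) : K⟦X⟧ :=
  1 + C α * (X * φ) + C β * (X * φ) ^ 2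

lemma constantCoeff_cubic (ε α β : K) : constantCoeff (cubic ε α β) = 0 := by simp [cubic]

lemma coeff_one_cubic (ε α β : K) : coeff 1 (cubic ε α β) = 1 + ε := by
  rw [cubic, map_add, map_add, coeff_C_mul, coeff_C_mul, coeff_C_mul, coeff_one_X, coeff_X_pow,
    coeff_X_pow, if_neg (by omega), if_neg (by omega)]
  ring

lemma subst_cubic (ε α β : K) (φ : K⟦X⟧) :
    (cubic ε α β).subst (X * φ) = X * φ * (1 + C ε * displacement α β φ) := by
  have hs : HasSubst (X * φ) := HasSubst.of_constantCoeff_zero' (by simp)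
  have hC (x : K) : (C x).subst (X * φ) = (C x : K⟦X⟧) := subst_C x
  rw [cubic, displacement, subst_add hs, subst_add hs, subst_mul hs, subst_mul hs, subst_mul hs,
    subst_pow hs, subst_pow hs, subst_X hs, hC, hC, hC, map_mul, map_mul, map_add, map_one]
  ring

lemma nearLinear_one_sub_one (φ : K⟦X⟧) : nearLinear 1 (φ - 1) = X * φ := by
  rw [nearLinear, map_one, one_mul, add_sub_cancel]

lemma exists_subst_nearLinear_eq_subst_cubic (hε : 1 + ε ≠ 0) (α β : K)
    (hφ : constantCoeff φ = 1) :
    ∃ r, constantCoeff r = 0 ∧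
      (X * φ).subst (nearLinear (1 + ε) r) = (cubic ε α β).subst (X * φ) := by
  rw [← nearLinear_one_sub_one]
  exact exists_subst_nearLinear_eq hε (by simp [hφ])
    (by rw [constantCoeff_subst_nearLinear, constantCoeff_cubic])
    (by rw [coeff_one_subst_nearLinear (by simp [hφ]), coeff_one_cubic, one_mul])

lemma multiplier_pow_mul_eq (hφ : φ ^ n * (1 - C γ * X ^ n) = 1)
    (h : (X * φ).subst (nearLinear L r) = X * φ * b) :
    (C L * (1 + r)) ^ n * (1 + C γ * X ^ n * (b ^ n - 1)) = b ^ n := by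
  have hT := hasSubst_nearLinear L r
  have hsubst := congrArg (subst (nearLinear L r))
    (show (X * φ) ^ n * (1 - C γ * X ^ n) = X ^ n by rw [mul_pow, mul_assoc, hφ, mul_one])
  have hC (x : K) : (C x).subst (nearLinear L r) = (C x : K⟦X⟧) := subst_C x
  rw [subst_mul hT, subst_sub hT, subst_mul hT, subst_pow hT, subst_pow hT, subst_X hT, hC, h,
    ← map_one C, hC, map_one, nearLinear, mul_right_comm, mul_comm _ X] at hsubst
  have hcancel : φ ^ n * b ^ n * (1 - C γ * X ^ n * (C L * (1 + r)) ^ n) =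
      (C L * (1 + r)) ^ n := by
    refine mul_left_cancel₀ (pow_ne_zero n (X_ne_zero (R := K))) ?_
    simp only [mul_pow] at hsubst ⊢
    linear_combination hsubst
  linear_combination (1 - C γ * X ^ n * (C L * (1 + r)) ^ n) * b ^ n * hφ -
    (1 - C γ * X ^ n) * hcancel

end Cubic

section LeadingPart

variable {K : Type*} [NormedField K] [IsUltrametricDist K] {ε α β x : K} {mu V : ℝ} {n : ℕ}
  {a b m q r N E φ : K⟦X⟧}

lemma one_add_ne_zero_of_norm_lt (hε : ‖ε‖ < 1) : 1 + ε ≠ 0 := by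
  rw [← norm_ne_zero_iff, norm_eq_one_of_norm_sub_one_lt (by rwa [add_sub_cancel_left])]
  exact one_ne_zero

lemma CoeffBound.multiplier_sub_one (hε : ‖ε‖ ≤ 1) (hq : CoeffBound 1 V q)
    (ha : CoeffBound 1 V a) (n : ℕ) :
    CoeffBound ‖ε‖ V (C (1 + ε) ^ n * (1 + q * ((1 + C ε * a) ^ n - 1)) - 1) := by
  have hpow : CoeffBound ‖ε‖ V (q * ((1 + C ε * a) ^ n - 1)) := by
    simpa using hq.mul (one_add_pow_sub_one (by simpa using ha.C_mul ε) hε n)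
  have hL : CoeffBound ‖ε‖ V (C (1 + ε) ^ n - 1) := by
    simpa using one_add_pow_sub_one (of_C hq.rate_nonneg ε) hε n
  rw [show C (1 + ε) ^ n * (1 + q * ((1 + C ε * a) ^ n - 1)) - 1 =
    C (1 + ε) ^ n * (q * ((1 + C ε * a) ^ n - 1)) + (C (1 + ε) ^ n - 1) by ring]
  exact add (by simpa using (hL.of_sub_one hε).mul hpow) hL

lemma CoeffBound.leading_part (hε : ‖ε‖ < 1) (hm : CoeffBound ‖ε‖ V (m - 1))
    (hN : CoeffBound mu V N) (hE : CoeffBound (‖ε‖ * mu) V E) (h : m * a = C ε * (N + E)) :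
    CoeffBound (‖ε‖ * mu) V a ∧ CoeffBound (‖ε‖ * (‖ε‖ * mu)) V (a - C ε * N) := by
  have hm0 : ‖constantCoeff m‖ = 1 := norm_eq_one_of_norm_sub_one_lt <| by
    simpa using (hm.norm_coeff_le 0).trans_lt (by simpa using hε)
  have hNE : CoeffBound mu V (N + E) :=
    hN.add (hE.mono (mul_le_of_le_one_left hN.nonneg hε.le))
  have ha : CoeffBound (‖ε‖ * mu) V a := (hm.of_sub_one hε.le).of_mul hm0 (h ▸ hNE.C_mul ε)
  refine ⟨ha, ?_⟩
  rw [show a - C ε * N = C ε * E - (m - 1) * a by linear_combination h]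
  exact (hE.C_mul ε).sub (hm.mul ha)

lemma CoeffBound.norm_coeff_eq {c d : ℝ} {k : ℕ} (h : CoeffBound c V (a - b)) (hV : 0 < V)
    (hcd : c < d) (hb : ‖coeff k b‖ = d * V ^ k) : ‖coeff k a‖ = d * V ^ k := by
  rw [← hb]
  refine norm_eq_of_norm_sub_lt ?_
  rw [← map_sub, hb]
  exact (h.norm_coeff_le k).trans_lt (mul_lt_mul_of_pos_right hcd (by positivity))

theorem not_isLocallyLinearizable_cubic {p : ℕ} [hp : Fact p.Prime] [CharP K p] (hp5 : 5 ≤ p)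
    (hε : ε ≠ 0) (hmu : ‖ε‖ ≤ mu) (hmu1 : mu < 1) (hV : 0 < V) (hφ0 : constantCoeff φ = 1)
    (hφ : CoeffBound 1 V φ) (hr0 : constantCoeff r = 0)
    (hconj : (X * φ).subst (nearLinear (1 + ε) r) = (cubic ε α β).subst (X * φ))
    (hr : CoeffBound (‖ε‖ * mu) V r) (hx : ‖x‖ = 1)
    (hlead : CoeffBound (‖ε‖ * (‖ε‖ * mu)) V (C x * r - C ε * N))
    (hdom : ‖coeff p N‖ = mu * V ^ p ∨ ‖coeff (p * 2) N‖ = mu * V ^ (p * 2) ∧ mu = ‖ε‖) :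
    ¬ IsLocallyLinearizable (cubic ε α β) := by
  have hε0 : 0 < ‖ε‖ := norm_pos_iff.2 hε
  have hε1 : ‖ε‖ < 1 := hmu.trans_lt hmu1
  have hsub : 1 + ε - 1 = ε := add_sub_cancel_left 1 ε
  have hcoeff {k : ℕ} (hk : ‖coeff k N‖ = mu * V ^ k) : ‖coeff k r‖ = ‖ε‖ * mu * V ^ k := by
    have hmu0 : 0 < mu := hε0.trans_le hmu
    simpa [hx] using hlead.norm_coeff_eq hV (mul_lt_of_lt_one_left (by positivity) hε1)
      (by rw [coeff_C_mul, norm_mul, hk, mul_assoc])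
  intro hlin
  rw [← nearLinear_one_sub_one] at hconj
  obtain ⟨u, D, hu, hD⟩ := exists_isCohomologicalSolution hlin (constantCoeff_cubic ε α β)
    (coeff_one_cubic ε α β) (one_add_ne_zero_of_norm_lt hε1) hε hε1 hr0 (by simp [hφ0])
    (hφ.sub (.one hV.le)) hconj
  refine hu.not_coeffBound (p := p) hp5 (by simpa using hε) (by rwa [hsub]) hmu1 hV
    (by rwa [hsub]) ?_ hD
  rw [hsub]
  exact hdom.imp hcoeff (And.imp_left hcoeff)

end LeadingPart

section QuadraticNumerator

variable {K : Type*} [Field K] {ε α β : K} {r φ : K⟦X⟧}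

lemma displacement_eq_of_mul_one_sub (hφ : φ * (1 - C α * X) = 1) (β : K) :
    displacement α β φ = φ + C β * X ^ 2 * φ ^ 2 := by
  rw [displacement]
  linear_combination -hφ

lemma multiplier_mul_eq_of_mul_one_sub (hφ : φ * (1 - C α * X) = 1)
    (hconj : (X * φ).subst (nearLinear (1 + ε) r) = (cubic ε α β).subst (X * φ)) :
    C (1 + ε) * (1 + C α * X * (C ε * displacement α β φ)) * r =
      C ε * (C β * X ^ 2 * φ - C ε * (C α * X * φ) +
        -(C ε * (C α * X * (C β * X ^ 2 * φ ^ 2)))) := by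
  have hmul := multiplier_pow_mul_eq (n := 1) (by simpa using hφ)
    (hconj.trans (subst_cubic ε α β φ))
  rw [displacement_eq_of_mul_one_sub hφ, map_add, map_one] at *
  linear_combination hmul + C ε * (1 + C β * X ^ 2 * φ) * hφ

lemma coeff_quadratic_leading (ε α β : K) (m : ℕ) :
    coeff (m + 2) (C β * X ^ 2 * mk (α ^ ·) - C ε * (C α * X * mk (α ^ ·))) =
      α ^ m * (β - ε * α ^ 2) := by
  rw [map_sub, coeff_C_mul, mul_assoc, mul_assoc, coeff_C_mul, coeff_C_mul, coeff_X_pow_mul,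
    coeff_succ_X_mul, coeff_mk, coeff_mk]
  ring

end QuadraticNumerator

section QuadraticCase

variable {K : Type*} [NormedField K] [IsUltrametricDist K] {ε α β : K} {mu : ℝ} {r φ : K⟦X⟧}

lemma quadratic_leading_part (hφ0 : φ * (1 - C α * X) = 1) (hφ : CoeffBound 1 ‖α‖ φ)
    (hε : ‖ε‖ ≤ mu) (hmu : mu < 1) (hβ : ‖β‖ ≤ mu * ‖α‖ ^ 2)
    (hconj : (X * φ).subst (nearLinear (1 + ε) r) = (cubic ε α β).subst (X * φ)) :
    CoeffBound (‖ε‖ * mu) ‖α‖ r ∧ CoeffBound (‖ε‖ * (‖ε‖ * mu)) ‖α‖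
      (r - C ε * (C β * X ^ 2 * φ - C ε * (C α * X * φ))) := by
  have hmu0 : 0 ≤ mu := (norm_nonneg ε).trans hε
  have hP : CoeffBound 1 ‖α‖ (C α * X) := by
    simpa using CoeffBound.C_mul_X_pow (m := 1) zero_le_one (norm_nonneg α) (by simp)
  have hQ : CoeffBound mu ‖α‖ (C β * X ^ 2) := .C_mul_X_pow hmu0 (norm_nonneg α) hβ
  have hQφ : CoeffBound mu ‖α‖ (C β * X ^ 2 * φ) := by simpa using hQ.mul hφ
  have hQφ2 : CoeffBound mu ‖α‖ (C β * X ^ 2 * φ ^ 2) := by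
    simpa only [mul_one] using hQ.mul hφ.sq
  have hA : CoeffBound 1 ‖α‖ (displacement α β φ) := by
    rw [displacement_eq_of_mul_one_sub hφ0]
    exact hφ.add (hQφ2.mono hmu.le)
  have hM : CoeffBound ‖ε‖ ‖α‖
      (C (1 + ε) * (1 + C α * X * (C ε * displacement α β φ)) - 1) := by
    simpa only [pow_one, add_sub_cancel_left] using
      CoeffBound.multiplier_sub_one (hε.trans hmu.le) hP hA 1
  have hN : CoeffBound mu ‖α‖ (C β * X ^ 2 * φ - C ε * (C α * X * φ)) :=
    hQφ.sub (((hP.mul hφ).C_mul ε).mono (by simpa using hε))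
  have hE : CoeffBound (‖ε‖ * mu) ‖α‖ (-(C ε * (C α * X * (C β * X ^ 2 * φ ^ 2)))) := by
    simpa only [one_mul] using ((hP.mul hQφ2).C_mul ε).neg
  exact CoeffBound.leading_part (hε.trans_lt hmu) hM hN hE
    (multiplier_mul_eq_of_mul_one_sub hφ0 hconj)

variable {p : ℕ} [hp : Fact p.Prime] [CharP K p]

theorem not_isLocallyLinearizable_cubic_of_norm_le (hp5 : 5 ≤ p) (hε : ε ≠ 0) (hα : α ≠ 0)
    (hmu : ‖ε‖ ≤ mu) (hmu1 : mu < 1) (hβ : ‖β‖ ≤ mu * ‖α‖ ^ 2)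
    (hres : ‖β - ε * α ^ 2‖ = mu * ‖α‖ ^ 2) : ¬ IsLocallyLinearizable (cubic ε α β) := by
  set φ : K⟦X⟧ := mk (α ^ ·) with hφ_def
  have hφ0 : constantCoeff φ = 1 := by simp [hφ_def, ← coeff_zero_eq_constantCoeff_apply]
  have hφ : CoeffBound 1 ‖α‖ φ := ⟨norm_nonneg α, fun k => by simp [hφ_def]⟩
  obtain ⟨r, hr0, hconj⟩ := exists_subst_nearLinear_eq_subst_cubic
    (one_add_ne_zero_of_norm_lt (hmu.trans_lt hmu1)) α β hφ0
  obtain ⟨hr, hlead⟩ := quadratic_leading_part (mk_pow_mul_one_sub α) hφ hmu hmu1 hβ hconj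
  refine not_isLocallyLinearizable_cubic (x := 1) hp5 hε hmu hmu1 (norm_pos_iff.2 hα) hφ0 hφ hr0
    hconj hr norm_one (by simpa using hlead) (.inl ?_)
  obtain ⟨m, hm⟩ := Nat.exists_eq_add_of_le' (show 2 ≤ p by omega)
  rw [hm, coeff_quadratic_leading, norm_mul, norm_pow, hres]
  ring

end QuadraticCase

section SquareRoot

variable {K : Type*}

lemma eq_expand_geometric [Field K] {β : K} {a : K⟦X⟧} (ha : a * (1 - C β * X ^ 2) = 1) :
    a = expand 2 two_ne_zero (mk (β ^ ·)) := by
  have hgeom := congrArg (expand 2 two_ne_zero) (mk_pow_mul_one_sub β)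
  rw [map_mul, map_sub, map_mul, map_one, expand_C, expand_X] at hgeom
  rw [← mul_one a, ← hgeom, mul_left_comm, ha, mul_one]

/-- The square root `1 - (β / 2) X ^ 2 ∑ₙ Cₙ (β X ^ 2 / 4) ^ n` of `1 - β X ^ 2`, where `Cₙ` are the
Catalan numbers. -/
noncomputable def sqrtOneSub [Field K] (β : K) : K⟦X⟧ :=
  1 - C (β / 2) * X ^ 2 *
    expand 2 two_ne_zero (rescale (β / 4) (map (Nat.castRingHom K) catalanSeries))

lemma constantCoeff_sqrtOneSub [Field K] (β : K) : constantCoeff (sqrtOneSub β) = 1 := by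
  simp [sqrtOneSub]

lemma sqrtOneSub_sq [Field K] (h2 : (2 : K) ≠ 0) (β : K) :
    sqrtOneSub β ^ 2 = 1 - C β * X ^ 2 := by
  have hcatalan := congrArg (fun s => expand 2 two_ne_zero
    (rescale (β / 4) (map (Nat.castRingHom K) s))) catalanSeries_sq_mul_X_add_one
  simp only [map_add, map_mul, map_pow, map_one, map_X, rescale_X, expand_C, expand_X] at hcatalan
  have hβ2 : (C β : K⟦X⟧) = 2 * C (β / 2) := by
    rw [← map_ofNat C, ← map_mul, mul_div_cancel₀ _ h2]
  have hβ4 : (C (β / 2) : K⟦X⟧) = 2 * C (β / 4) := by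
    rw [← map_ofNat C, ← map_mul, show (4 : K) = 2 * 2 by norm_num, ← div_div,
      mul_div_cancel₀ _ h2]
  rw [sqrtOneSub, hβ2, hβ4]
  linear_combination (4 * C (β / 4) * X ^ 2) * hcatalan

lemma coeff_catalan_expand [Field K] (γ : K) (n : ℕ) :
    coeff (2 * n) (expand 2 two_ne_zero (rescale γ (map (Nat.castRingHom K) catalanSeries))) =
      γ ^ n * catalan n := by
  rw [coeff_expand_mul, coeff_rescale, coeff_map, catalanSeries_coeff, eq_natCast]

variable [NormedField K] {p : ℕ} [hp : Fact p.Prime] [CharP K p]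

lemma norm_catalan_eq_one {n : ℕ} (hn : 2 * n < p) : ‖(catalan n : K)‖ = 1 := by
  refine norm_natCast_eq_one_of_not_dvd (p := p) fun hdvd => ?_
  have hcentral : p ∣ n.centralBinom := by
    rw [← succ_mul_catalan_eq_centralBinom]
    exact hdvd.mul_left _
  have hfactorial : p ∣ (2 * n).factorial := by
    rw [← Nat.choose_mul_factorial_mul_factorial (show n ≤ 2 * n by omega)]
    exact (hcentral.mul_right _).mul_right _
  exact absurd (hp.out.dvd_factorial.1 hfactorial) (by omega)

lemma norm_coeff_sqrtOneSub (h2 : ‖(2 : K)‖ = 1) (β : K) {n : ℕ} (hn : 2 * n < p) :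
    ‖coeff (2 * n + 2) (sqrtOneSub β)‖ = ‖β‖ ^ (n + 1) := by
  have h4 : ‖(4 : K)‖ = 1 := by rw [show (4 : K) = 2 * 2 by norm_num, norm_mul, h2, one_mul]
  rw [sqrtOneSub, map_sub, coeff_one, if_neg (by omega), zero_sub, norm_neg, mul_assoc, coeff_C_mul,
    coeff_X_pow_mul, coeff_catalan_expand, norm_mul, norm_mul, norm_pow, norm_div, norm_div, h2, h4,
    norm_catalan_eq_one hn, div_one, mul_one, pow_succ']

lemma CoeffBound.sqrtOneSub [IsUltrametricDist K] (h2 : ‖(2 : K)‖ = 1) {β : K} {V : ℝ} (hV : 0 ≤ V)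
    (hβ : ‖β‖ = V ^ 2) : CoeffBound 1 V (sqrtOneSub β) := by
  have h4 : ‖(4 : K)‖ = 1 := by rw [show (4 : K) = 2 * 2 by norm_num, norm_mul, h2, one_mul]
  have hcatalan : CoeffBound 1 V
      (expand 2 two_ne_zero (rescale (β / 4) (map (Nat.castRingHom K) catalanSeries))) := by
    refine ⟨hV, fun k => ?_⟩
    by_cases hk : 2 ∣ k
    · obtain ⟨n, rfl⟩ := hk
      rw [coeff_catalan_expand, norm_mul, norm_pow, norm_div, h4, hβ, div_one, ← pow_mul, one_mul]
      exact mul_le_of_le_one_right (by positivity) (IsUltrametricDist.norm_natCast_le_one K _)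
    · rw [coeff_expand_of_not_dvd 2 _ _ hk, norm_zero]
      positivity
  have hβ2 : CoeffBound 1 V (C (β / 2) * X ^ 2) :=
    C_mul_X_pow zero_le_one hV (by rw [norm_div, h2, hβ, div_one, one_mul])
  exact (one hV).sub (by simpa only [one_mul] using hβ2.mul hcatalan)

end SquareRoot

section CubicNumerator

variable {K : Type*} [Field K] {ε α β : K} {r σ φ : K⟦X⟧}

lemma displacement_eq_of_sq_mul_one_sub (hφ : φ ^ 2 * (1 - C β * X ^ 2) = 1) (α : K) :
    displacement α β φ = φ ^ 2 + C α * X * φ := by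
  rw [displacement]
  linear_combination -hφ

lemma cubic_numerator_eq {R : Type*} [CommRing R] {e P Q A φ σ : R} (hφ : φ ^ 2 * (1 - Q) = 1)
    (hσ : φ * (1 - Q) = σ) (hA : A = φ ^ 2 + P * φ) :
    (1 + e * A) ^ 2 - (1 + e) ^ 2 * (1 + Q * ((1 + e * A) ^ 2 - 1)) =
      e * (2 * (P * σ) - e * (3 * (φ ^ 2 - 1)) +
        e * (P * (φ + A * σ - 4 * (Q * φ)) - e * (Q * (2 * A + (2 + e) * A ^ 2)))) := by
  have hAQ : A * (1 - Q) = 1 + P * σ := by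
    linear_combination (1 - Q) * hA + hφ + P * hσ
  linear_combination (2 * e + e * e * A) * hAQ + e * e * (1 - 4 * Q) * hA + 4 * e * e * hφ

lemma multiplier_mul_eq_of_sq_mul_one_sub (hφ : φ ^ 2 * (1 - C β * X ^ 2) = 1)
    (hσ : φ * (1 - C β * X ^ 2) = σ)
    (hconj : (X * φ).subst (nearLinear (1 + ε) r) = (cubic ε α β).subst (X * φ)) :
    C (1 + ε) ^ 2 * (1 + C β * X ^ 2 * ((1 + C ε * displacement α β φ) ^ 2 - 1)) *
        (2 * r + r ^ 2) =
      C ε * (2 * (C α * X * σ) - C ε * (3 * (φ ^ 2 - 1)) +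
        C ε * (C α * X * (φ + displacement α β φ * σ - 4 * (C β * X ^ 2 * φ)) -
          C ε * (C β * X ^ 2 * (2 * displacement α β φ +
            (2 + C ε) * displacement α β φ ^ 2)))) := by
  have hmul := multiplier_pow_mul_eq hφ (hconj.trans (subst_cubic ε α β φ))
  rw [← cubic_numerator_eq hφ hσ (displacement_eq_of_sq_mul_one_sub hφ α)]
  rw [map_add, map_one] at *
  linear_combination hmul

lemma coeff_odd_cubic_leading (hφ : φ ^ 2 * (1 - C β * X ^ 2) = 1) (ε α : K) (σ : K⟦X⟧) (m : ℕ) :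
    coeff (2 * m + 3) (2 * (C α * X * σ) - C ε * (3 * (φ ^ 2 - 1))) =
      2 * (α * coeff (2 * m + 2) σ) := by
  rw [eq_expand_geometric hφ, ← map_ofNat C, ← map_ofNat C 3, mul_assoc (C α), map_sub, coeff_C_mul,
    coeff_C_mul, coeff_C_mul, coeff_C_mul, coeff_succ_X_mul, map_sub,
    coeff_expand_of_not_dvd 2 _ _ (by omega), coeff_one, if_neg (by omega), sub_zero, mul_zero,
    mul_zero, sub_zero]

lemma coeff_even_cubic_leading (hφ : φ ^ 2 * (1 - C β * X ^ 2) = 1) (ε α : K) (σ : K⟦X⟧) (m : ℕ) :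
    coeff (2 * (m + 1)) (2 * (C α * X * σ) - C ε * (3 * (φ ^ 2 - 1))) =
      2 * (α * coeff (2 * m + 1) σ) - ε * (3 * β ^ (m + 1)) := by
  rw [eq_expand_geometric hφ, ← map_ofNat C, ← map_ofNat C 3, mul_assoc (C α), map_sub, coeff_C_mul,
    coeff_C_mul, coeff_C_mul, coeff_C_mul, map_sub,
    coeff_expand_mul, coeff_mk, coeff_one, if_neg (by omega), sub_zero,
    show 2 * (m + 1) = 2 * m + 1 + 1 by ring, coeff_succ_X_mul]

end CubicNumerator

section CubicCase

variable {K : Type*} [NormedField K] [IsUltrametricDist K] {ε α β : K} {mu V : ℝ} {r σ φ : K⟦X⟧}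

lemma cubic_remainder_bound {P Q A : K⟦X⟧} (hε : ‖ε‖ ≤ mu) (hmu : mu < 1) (hP : CoeffBound mu V P)
    (hQ : CoeffBound 1 V Q) (hA : CoeffBound 1 V A) (hσ : CoeffBound 1 V σ)
    (hφ : CoeffBound 1 V φ) :
    CoeffBound (‖ε‖ * mu) V
      (C ε * (P * (φ + A * σ - 4 * (Q * φ)) - C ε * (Q * (2 * A + (2 + C ε) * A ^ 2)))) := by
  have hlinear : CoeffBound 1 V (φ + A * σ - 4 * (Q * φ)) :=
    (hφ.add (by simpa using hA.mul hσ)).sub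
      (by exact_mod_cast (show CoeffBound 1 V (Q * φ) by simpa using hQ.mul hφ).natCast_mul 4)
  have hfactor : CoeffBound 1 V (2 + C ε) := by
    simpa using ((CoeffBound.one hP.rate_nonneg).natCast_mul 2).add
      ((CoeffBound.of_C hP.rate_nonneg ε).mono (hε.trans hmu.le))
  have hquadratic : CoeffBound 1 V (2 * A + (2 + C ε) * A ^ 2) :=
    .add (by exact_mod_cast hA.natCast_mul 2) (by simpa only [one_mul] using hfactor.mul hA.sq)
  refine CoeffBound.C_mul (.sub (by simpa only [mul_one] using hP.mul hlinear) ?_) ε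
  exact ((hQ.mul hquadratic).C_mul ε).mono (by simpa using hε)

lemma cubic_leading_part (h2 : ‖(2 : K)‖ = 1) (hσ2 : σ ^ 2 = 1 - C β * X ^ 2) (hσφ : σ * φ = 1)
    (hσ : CoeffBound 1 V σ) (hφ : CoeffBound 1 V φ) (hε : ‖ε‖ ≤ mu) (hmu : mu < 1)
    (hα : ‖α‖ ≤ mu * V) (hβ : ‖β‖ ≤ V ^ 2) (hr0 : constantCoeff r = 0)
    (hconj : (X * φ).subst (nearLinear (1 + ε) r) = (cubic ε α β).subst (X * φ)) :
    CoeffBound (‖ε‖ * mu) V r ∧ CoeffBound (‖ε‖ * (‖ε‖ * mu)) V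
      (C 2 * r - C ε * (2 * (C α * X * σ) - C ε * (3 * (φ ^ 2 - 1)))) := by
  have hmu0 : 0 ≤ mu := (norm_nonneg ε).trans hε
  have hV := hσ.rate_nonneg
  have hφ0 : φ ^ 2 * (1 - C β * X ^ 2) = 1 := by
    linear_combination -φ ^ 2 * hσ2 + (σ * φ + 1) * hσφ
  have hφQ : φ * (1 - C β * X ^ 2) = σ := by linear_combination -φ * hσ2 + σ * hσφ
  have hP : CoeffBound mu V (C α * X) := by
    simpa using CoeffBound.C_mul_X_pow (m := 1) hmu0 hV (by simpa using hα)
  have hQ : CoeffBound 1 V (C β * X ^ 2) := .C_mul_X_pow zero_le_one hV (by simpa using hβ)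
  have hA : CoeffBound 1 V (displacement α β φ) := by
    rw [displacement_eq_of_sq_mul_one_sub hφ0]
    exact hφ.sq.add ((hP.mul hφ).mono (by simpa using hmu.le))
  have hN : CoeffBound mu V (2 * (C α * X * σ) - C ε * (3 * (φ ^ 2 - 1))) := by
    refine .sub (by exact_mod_cast (show CoeffBound mu V (C α * X * σ) by
      simpa using hP.mul hσ).natCast_mul 2) ?_
    exact (((hφ.sq.sub (.one hV)).natCast_mul 3).C_mul ε).mono (by simpa using hε)
  obtain ⟨hx, hlead⟩ := CoeffBound.leading_part (hε.trans_lt hmu)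
    (CoeffBound.multiplier_sub_one (hε.trans hmu.le) hQ hA 2) hN
    (cubic_remainder_bound hε hmu hP hQ hA hσ hφ)
    (multiplier_mul_eq_of_sq_mul_one_sub hφ0 hφQ hconj)
  have hr : CoeffBound (‖ε‖ * mu) V r :=
    hx.of_two_mul_add_sq hr0 h2 (mul_le_one₀ (hε.trans hmu.le) hmu0 hmu.le)
  refine ⟨hr, ?_⟩
  have hsq : CoeffBound (‖ε‖ * (‖ε‖ * mu)) V (r ^ 2) := by
    rw [pow_two]
    exact (hr.mul hr).mono (mul_le_mul_of_nonneg_right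
      (mul_le_of_le_one_right (norm_nonneg ε) hmu.le) hr.nonneg)
  convert hlead.sub hsq using 1
  rw [map_ofNat]
  ring

variable {p : ℕ} [hp : Fact p.Prime] [CharP K p]

lemma cubic_leading_dominant (h2 : ‖(2 : K)‖ = 1) (h3 : ‖(3 : K)‖ = 1) (hp3 : 3 ≤ p) (hV : 0 < V)
    (hβ : ‖β‖ = V ^ 2) (hφ : φ ^ 2 * (1 - C β * X ^ 2) = 1)
    (hmu : mu = max (‖α‖ / V) ‖ε‖) :
    ‖coeff p (2 * (C α * X * sqrtOneSub β) - C ε * (3 * (φ ^ 2 - 1)))‖ = mu * V ^ p ∨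
      ‖coeff (p * 2) (2 * (C α * X * sqrtOneSub β) - C ε * (3 * (φ ^ 2 - 1)))‖ =
        mu * V ^ (p * 2) ∧ mu = ‖ε‖ := by
  rcases le_or_gt ‖ε‖ (‖α‖ / V) with hc | hc
  · left
    obtain ⟨m, hm⟩ : ∃ m, p = 2 * m + 3 := by
      obtain ⟨s, hs⟩ := hp.out.odd_of_ne_two (by omega)
      exact ⟨s - 1, by omega⟩
    rw [hm, coeff_odd_cubic_leading hφ, norm_mul, norm_mul, h2,
      norm_coeff_sqrtOneSub (p := p) h2 β (by omega), hβ, hmu, max_eq_left hc]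
    field_simp
    ring
  · rw [max_eq_right hc.le] at hmu
    refine .inr ⟨?_, hmu⟩
    obtain ⟨m, hm⟩ := Nat.exists_eq_add_of_le' (show 1 ≤ p by omega)
    have hb : ‖-(ε * (3 * β ^ (m + 1)))‖ = mu * V ^ (p * 2) := by
      rw [norm_neg, norm_mul, norm_mul, norm_pow, h3, hβ, hmu, one_mul, ← pow_mul, hm, mul_comm 2]
    have hsmall : ‖2 * (α * coeff (2 * m + 1) (sqrtOneSub β))‖ < mu * V ^ (p * 2) := by
      rw [norm_mul, norm_mul, h2, one_mul]
      calc ‖α‖ * ‖coeff (2 * m + 1) (sqrtOneSub β)‖ ≤ ‖α‖ * (1 * V ^ (2 * m + 1)) := by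
            gcongr
            exact (CoeffBound.sqrtOneSub h2 hV.le hβ).norm_coeff_le _
        _ = ‖α‖ / V * V ^ (p * 2) := by rw [hm]; field_simp; ring
        _ < mu * V ^ (p * 2) := by rw [hmu]; gcongr
    rw [← hb, mul_comm p, hm, coeff_even_cubic_leading hφ, sub_eq_add_neg]
    refine norm_eq_of_norm_sub_lt ?_
    rwa [add_sub_cancel_right, hb]

theorem not_isLocallyLinearizable_cubic_of_sq_norm_lt (hp5 : 5 ≤ p) (hε : ε ≠ 0) (hε1 : ‖ε‖ < 1)
    (hαβ : ‖α‖ ^ 2 < ‖β‖) : ¬ IsLocallyLinearizable (cubic ε α β) := by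
  have h2 : ‖(2 : K)‖ = 1 := by
    exact_mod_cast norm_natCast_eq_one_of_not_dvd (K := K) (p := p) (k := 2)
      (Nat.not_dvd_of_pos_of_lt two_pos (by omega))
  have h3 : ‖(3 : K)‖ = 1 := by
    exact_mod_cast norm_natCast_eq_one_of_not_dvd (K := K) (p := p) (k := 3)
      (Nat.not_dvd_of_pos_of_lt three_pos (by omega))
  have hβ0 : 0 < ‖β‖ := (sq_nonneg ‖α‖).trans_lt hαβ
  obtain ⟨V, hV, hβ⟩ : ∃ V : ℝ, 0 < V ∧ ‖β‖ = V ^ 2 :=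
    ⟨√‖β‖, Real.sqrt_pos.2 hβ0, (Real.sq_sqrt hβ0.le).symm⟩
  have hαV : ‖α‖ < V := lt_of_pow_lt_pow_left₀ 2 hV.le (hβ ▸ hαβ)
  set mu := max (‖α‖ / V) ‖ε‖ with hmu
  have hmu1 : mu < 1 := max_lt ((div_lt_one hV).2 hαV) hε1
  set σ := sqrtOneSub β
  have hσ0 : constantCoeff σ = 1 := constantCoeff_sqrtOneSub β
  have hσ2 : σ ^ 2 = 1 - C β * X ^ 2 := sqrtOneSub_sq (norm_pos_iff.1 (h2 ▸ one_pos)) β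
  have hσ : CoeffBound 1 V σ := .sqrtOneSub h2 hV.le hβ
  have hσφ : σ * σ⁻¹ = 1 := PowerSeries.mul_inv_cancel σ (by simp [hσ0])
  have hφ : CoeffBound 1 V σ⁻¹ := hσ.of_mul (by simp [hσ0]) (hσφ ▸ .one hV.le)
  have hφ0 : constantCoeff σ⁻¹ = 1 := by simp [constantCoeff_inv, hσ0]
  obtain ⟨r, hr0, hconj⟩ := exists_subst_nearLinear_eq_subst_cubic
    (one_add_ne_zero_of_norm_lt hε1) α β hφ0
  obtain ⟨hr, hlead⟩ := cubic_leading_part h2 hσ2 hσφ hσ hφ (le_max_right _ _) hmu1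
    ((div_le_iff₀ hV).1 (le_max_left _ _)) hβ.le hr0 hconj
  refine not_isLocallyLinearizable_cubic hp5 hε (le_max_right _ _) hmu1 hV hφ0 hφ hr0 hconj hr h2
    hlead (cubic_leading_dominant h2 h3 (by omega) hV hβ ?_ hmu)
  linear_combination -σ⁻¹ ^ 2 * hσ2 + (σ * σ⁻¹ + 1) * hσφ

end CubicCase

section DominantTerm

variable {K : Type*} [NormedField K] {ε α β : K}

lemma norm_sub_mul_sq (hε : ε ≠ 0) (hα : α ≠ 0) (β : K) :
    ‖β - ε * α ^ 2‖ = ‖ε‖ * ‖1 - ε * β / (ε * α) ^ 2‖ * ‖α‖ ^ 2 := by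
  rw [← norm_neg, ← norm_pow, ← norm_mul, ← norm_mul]
  congr 1
  field_simp
  ring

variable [IsUltrametricDist K] {p : ℕ} [Fact p.Prime] [CharP K p]

lemma norm_lt_of_sq_norm_lt_norm_sub (hε : ‖ε‖ < 1) (h : ‖α‖ ^ 2 < ‖β - ε * α ^ 2‖) :
    ‖α‖ ^ 2 < ‖β‖ := by
  rwa [norm_eq_of_norm_sub_lt (x := β) (y := β - ε * α ^ 2)]
  rw [sub_sub_cancel, norm_mul, norm_pow]
  exact (mul_le_of_le_one_left (by positivity) hε.le).trans_lt h

theorem not_isLocallyLinearizable_cubic_of_norm_sub_ne (hp5 : 5 ≤ p) (hε : ε ≠ 0) (hε1 : ‖ε‖ < 1)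
    (hα : α ≠ 0) (hge : ‖ε * α ^ 2‖ ≤ ‖β - ε * α ^ 2‖) (hne : ‖β - ε * α ^ 2‖ ≠ ‖α‖ ^ 2) :
    ¬ IsLocallyLinearizable (cubic ε α β) := by
  rcases hne.lt_or_gt with hlt | hgt
  · have hα2 : 0 < ‖α‖ ^ 2 := by positivity
    obtain ⟨mu, hmu⟩ : ∃ mu, ‖β - ε * α ^ 2‖ = mu * ‖α‖ ^ 2 := ⟨_, (div_mul_cancel₀ _ hα2.ne').symm⟩
    have hβ : ‖β‖ ≤ ‖β - ε * α ^ 2‖ := by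
      have hsub := norm_sub_le_of_norm_le le_rfl (norm_neg (ε * α ^ 2) ▸ hge)
      rwa [sub_neg_eq_add, sub_add_cancel] at hsub
    rw [norm_mul, norm_pow, hmu] at hge
    exact not_isLocallyLinearizable_cubic_of_norm_le hp5 hε hα (le_of_mul_le_mul_right hge hα2)
      (by rwa [hmu, mul_lt_iff_lt_one_left hα2] at hlt) (hmu ▸ hβ) hmu
  · exact not_isLocallyLinearizable_cubic_of_sq_norm_lt hp5 hε hε1
      (norm_lt_of_sq_norm_lt_norm_sub hε1 hgt)

end DominantTerm

end LocalLinearization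

theorem theorem1p6_general {K : Type*} [NormedField K] [IsUltrametricDist K]
    (p : ℕ) (hp : p.Prime) [CharP K p] (hp5 : 5 ≤ p)
    (lam a₁ a₂ : K)
    (hlam : lam ≠ 1)
    (hlam1 : ‖1 - lam‖ < 1)
    (ha₁ : a₁ ≠ 0)
    (hge : 1 ≤ ‖1 - a₂ / a₁ ^ 2‖)
    (hne : ‖1 - a₂ / a₁ ^ 2‖ ≠ 1 / ‖1 - lam‖) :
    ¬ IsLocallyLinearizable
      (PowerSeries.C lam * PowerSeries.X + PowerSeries.C a₁ * PowerSeries.X ^ 2 +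
        PowerSeries.C a₂ * PowerSeries.X ^ 3) := by
  have : Fact p.Prime := ⟨hp⟩
  obtain ⟨ε, rfl⟩ : ∃ ε, lam = 1 + ε := ⟨lam - 1, by ring⟩
  have hε : ε ≠ 0 := by simpa using hlam
  obtain ⟨α, rfl⟩ : ∃ α, a₁ = ε * α := ⟨a₁ / ε, by field_simp⟩
  obtain ⟨β, rfl⟩ : ∃ β, a₂ = ε * β := ⟨a₂ / ε, by field_simp⟩
  have hα : α ≠ 0 := right_ne_zero_of_mul ha₁
  have hα2 : 0 < ‖α‖ ^ 2 := by positivity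
  rw [sub_add_cancel_left, norm_neg] at hlam1 hne
  have hnorm := LocalLinearization.norm_sub_mul_sq hε hα β
  refine LocalLinearization.not_isLocallyLinearizable_cubic_of_norm_sub_ne hp5 hε hlam1 hα ?_ ?_
  · rw [hnorm, norm_mul, norm_pow]
    gcongr
    exact le_mul_of_one_le_right (norm_nonneg ε) hge
  · rw [hnorm, Ne, mul_eq_right₀ hα2.ne', mul_comm]
    rwa [Ne, eq_div_iff (norm_ne_zero_iff.2 hε)] at hne

theorem theorem1p6 {K : Type*} [NormedField K] [IsUltrametricDist K] [CompleteSpace K]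
    (p : ℕ) (hp : p.Prime) [CharP K p] (hp5 : 5 ≤ p)
    (lam a₁ a₂ : K)
    (hlam : ∀ n : ℕ, 0 < n → lam ^ n ≠ 1)
    (hlam1 : ‖1 - lam‖ < 1)
    (ha₁ : a₁ ≠ 0)
    (hge : 1 ≤ ‖1 - a₂ / a₁ ^ 2‖)
    (hne : ‖1 - a₂ / a₁ ^ 2‖ ≠ 1 / ‖1 - lam‖) :
    ¬ IsLocallyLinearizable
      (PowerSeries.C lam * PowerSeries.X + PowerSeries.C a₁ * PowerSeries.X ^ 2 +
        PowerSeries.C a₂ * PowerSeries.X ^ 3) :=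
  theorem1p6_general p hp hp5 lam a₁ a₂ (by simpa using hlam 1 one_pos) hlam1 ha₁ hge hne
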